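/- Conventions. Let $R$ be a commutative ring and $\underline{x}=x_1,\dots,x_\ell$ a finite sequence in $R$. For $m\ge n$ let $\varphi^m_n:\mathbb{K}_\bullet(\underline{x}^m)\to\mathbb{K}_\bullet(\underline{x}^n)$ be the chain map of Koszul complexes given by $e_{j_1}\wedge\dots\wedge e_{j_i}\mapsto (x_{j_1}\cdots x_{j_i})^{m-n}\,e_{j_1}\wedge\dots\wedge e_{j_i}$, where $\underline{x}^n=x_1^n,\dots,x_\ell^n$. The sequence $\underline{x}$ is weakly proregular if for every $n>0$ there is $m\ge n$ such that $H_i(\varphi^m_n)=0$ for all $i\ge 1$. It is a parameter sequence on $R$ if (1) it is weakly proregular, (2) $(\underline{x})R\neq R$, and (3) $H^\ell_{\underline{x}}(R)_{\mathfrak p}\ne 0$ for every prime ideal $\mathfrak p\supseteq(\underline{x})R$, where $H^\ell_{\underline{x}}(R)$ is the $\ell$-th cohomology of the Čech complex of $R$ with respect to $\underline{x}$. It is a strong parameter sequence if $x_1,\dots,x_i$ is a parameter sequence for all $1\le i\le\ell$. The ring $R$ is Cohen–Macaulay in the sense of Hamilton–Marley if every strong parameter sequence on $R$ (of length $\ell\geq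 1$) is a regular sequence. A quasi-rational plane cone is an intersection $L_1\cap L_2\subseteq\mathbb{R}^2$, where each $L_i$ is an open half plane $\{f>0\}$ or a closed half plane $\{f\ge 0\}$ for a nonzero linear form $f:\mathbb{R}^2\to\mathbb{R}$ whose zero line has rational (possibly infinite) slope. Its lattice monoid is $D=(L_1\cap L_2\cap\mathbb{Z}^2)\cup\{0\}$. Theorem. Let $k$ be a field, let $D$ be the lattice monoid of a quasi-rational plane cone, and let $C\subseteq D$ be a submonoid such that the extension $C\subseteq D$ is full (if $a,b\in C$ and $a-b\in D$, then $a-b\in C$) and integral (for every $d\in D$ there is an integer $t\ge 1$ with $td\in C$); for example $C=D$. Then $C$ is normal (if $a,b\in C$ and $t(a-b)\in C$ for some integer $t\ge1$, then $a-b\in C$), and every parameter sequence of the monoid algebra $k[C]$ is a regular sequence. In particular $k[C]$ is Cohen–Macaulay in the sense of Hamilton–Marley. -/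

import Mathlib

/-! ### Koszul complexes and weakly proregular sequences -/

section Koszul

variable {R : Type*} [CommRing R] {l : ℕ}

/-- The sign `(-1) ^ #{a ∈ s | a < j}` of the index `j` relative to the set `s`. -/
def indexSign (s : Finset (Fin l)) (j : Fin l) : ℤ :=
  (-1) ^ (s.filter (fun a => a < j)).card

theorem indexSign_insert {s : Finset (Fin l)} {i j : Fin l} (hj : j ∉ s) :
    indexSign (insert j s) i = if j < i then -indexSign s i else indexSign s i := by
  unfold indexSign
  rw [Finset.filter_insert]
  split_ifs with h
  · rw [Finset.card_insert_of_notMem (by simp [hj]), pow_succ]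
    ring
  · rfl

theorem indexSign_swap {s : Finset (Fin l)} {i j : Fin l} (hij : i ≠ j) (hi : i ∉ s)
    (hj : j ∉ s) :
    indexSign s j * indexSign (insert j s) i + indexSign s i * indexSign (insert i s) j = 0 := by
  rw [indexSign_insert hj, indexSign_insert hi]
  rcases lt_or_gt_of_ne hij with h | h
  · rw [if_neg h.not_gt, if_pos h]; ring
  · rw [if_pos h, if_neg h.not_gt]; ring

/-- The differential of the Koszul complex `K(y)` of `y = (y_1, …, y_l)`. The function
`c : Finset (Fin l) → R` stands for `∑ c s • e_s`, where `e_s = e_{j_1} ∧ ⋯ ∧ e_{j_i}` for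
`s = {j_1 < ⋯ < j_i}`, and `e_{j_1} ∧ ⋯ ∧ e_{j_i}` is sent to the alternating sum of the
`y_{j_r} • e_{j_1} ∧ ⋯ (omit e_{j_r}) ⋯ ∧ e_{j_i}`. -/
def koszulD (y : Fin l → R) : (Finset (Fin l) → R) →ₗ[R] (Finset (Fin l) → R) where
  toFun c := fun t => ∑ j ∈ tᶜ, indexSign t j • (y j * c (insert j t))
  map_add' c c' := by
    funext t
    simp [mul_add, smul_add, Finset.sum_add_distrib]
  map_smul' r c := by
    funext t
    simp only [Pi.smul_apply, smul_eq_mul, RingHom.id_apply, Finset.mul_sum]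
    refine Finset.sum_congr rfl fun j _ => ?_
    simp only [zsmul_eq_mul]
    ring

/-- The elements of the Koszul complex that are homogeneous of degree `i`. -/
def koszulDegree (R : Type*) [CommRing R] (l i : ℕ) : Submodule R (Finset (Fin l) → R) where
  carrier := {c | ∀ s, s.card ≠ i → c s = 0}
  add_mem' hc hc' s hs := by simp [hc s hs, hc' s hs]
  zero_mem' _ _ := rfl
  smul_mem' r c hc s hs := by simp [hc s hs]

/-- `i`-cycles of the Koszul complex of `y`. -/
def koszulCycles (y : Fin l → R) (i : ℕ) : Submodule R (Finset (Fin l) → R) :=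
  koszulDegree R l i ⊓ LinearMap.ker (koszulD y)

/-- `i`-boundaries of the Koszul complex of `y`. -/
def koszulBoundaries (y : Fin l → R) (i : ℕ) : Submodule R (Finset (Fin l) → R) :=
  (koszulDegree R l (i + 1)).map (koszulD y)

/-- The chain map `φ^m_n : K(x^m) → K(x^n)`, `e_s ↦ (∏_{j ∈ s} x_j)^(m - n) • e_s`, for
`n ≤ m`. -/
def koszulPhi (x : Fin l → R) (m n : ℕ) : (Finset (Fin l) → R) →ₗ[R] (Finset (Fin l) → R) where
  toFun c := fun s => (∏ j ∈ s, x j) ^ (m - n) * c s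
  map_add' c c' := by funext s; simp [mul_add]
  map_smul' r c := by funext s; simp; ring

/-- `x` is weakly proregular: for every `n > 0` there is `m ≥ n` such that
`φ^m_n` induces the zero map `H_i(K(x^m)) → H_i(K(x^n))` for all `i ≥ 1`, i.e. sends
`i`-cycles to `i`-boundaries. -/
def IsWeaklyProregular (x : Fin l → R) : Prop :=
  ∀ n : ℕ, 0 < n → ∃ m : ℕ, n ≤ m ∧ ∀ i : ℕ, 1 ≤ i →
    ∀ z ∈ koszulCycles (fun j => x j ^ m) i,
      koszulPhi x m n z ∈ koszulBoundaries (fun j => x j ^ n) i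

/-- The Koszul differential squares to zero. -/
theorem koszulD_koszulD (y : Fin l → R) (c : Finset (Fin l) → R) :
    koszulD y (koszulD y c) = 0 := by
  funext t
  simp only [koszulD, LinearMap.coe_mk, AddHom.coe_mk, Pi.zero_apply, Finset.mul_sum,
    Finset.smul_sum]
  rw [Finset.sum_sigma']
  refine Finset.sum_involution (fun p _ => ⟨p.2, p.1⟩) ?_ ?_ ?_ ?_
  · rintro ⟨j, i⟩ h
    simp only [Finset.mem_sigma, Finset.mem_compl, Finset.mem_insert, not_or] at h
    obtain ⟨hj, hij, hi⟩ := h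
    have key := congrArg (Int.cast : ℤ → R) (indexSign_swap hij hi hj)
    push_cast at key
    rw [Finset.insert_comm i j t]
    simp only [zsmul_eq_mul]
    linear_combination (y i * y j * c (insert j (insert i t))) * key
  · rintro ⟨j, i⟩ h _ heq
    simp only [Finset.mem_sigma, Finset.mem_compl, Finset.mem_insert, not_or] at h
    exact h.2.1 (congrArg Sigma.fst heq)
  · rintro ⟨j, i⟩ h
    simp only [Finset.mem_sigma, Finset.mem_compl, Finset.mem_insert, not_or] at h ⊢
    exact ⟨h.2.2, fun e => h.2.1 e.symm, h.1⟩
  · rintro ⟨j, i⟩ _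
    rfl

/-- `φ^m_n` is a chain map. -/
theorem koszulD_koszulPhi (x : Fin l → R) {m n : ℕ} (h : n ≤ m) (c : Finset (Fin l) → R) :
    koszulD (fun j => x j ^ n) (koszulPhi x m n c) =
      koszulPhi x m n (koszulD (fun j => x j ^ m) c) := by
  funext t
  simp only [koszulD, koszulPhi, LinearMap.coe_mk, AddHom.coe_mk, Finset.mul_sum]
  refine Finset.sum_congr rfl fun j hj => ?_
  rw [Finset.prod_insert (by simpa using hj), ← Nat.sub_add_cancel h, pow_add,
    Nat.add_sub_cancel, mul_pow]
  simp only [zsmul_eq_mul]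
  ring

end Koszul

/-! ### Čech cohomology -/

section Cech

variable {R : Type*} [CommRing R] {l : ℕ}

/-- The localization `R_{x_s}` with `x_s = ∏_{j ∈ s} x_j`. -/
abbrev CechTerm (x : Fin l → R) (s : Finset (Fin l)) : Type _ :=
  Localization.Away (∏ j ∈ s, x j)

/-- The localization map `R_{x_s} → R_{x_t}` for `s ⊆ t`. -/
noncomputable def cechRes (x : Fin l → R) {s t : Finset (Fin l)} (h : s ⊆ t) :
    CechTerm x s →ₐ[R] CechTerm x t :=
  IsLocalization.liftAlgHom (M := Submonoid.powers (∏ j ∈ s, x j))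
    (f := Algebra.ofId R (CechTerm x t)) (by
      rintro ⟨_, n, rfl⟩
      have h1 : IsUnit (algebraMap R (CechTerm x t) (∏ j ∈ s, x j)) := by
        refine isUnit_of_dvd_unit ?_
          (IsLocalization.Away.algebraMap_isUnit (S := CechTerm x t) (∏ j ∈ t, x j))
        exact map_dvd _ (Finset.prod_dvd_prod_of_subset _ _ _ h)
      simpa [Algebra.ofId_apply] using h1.pow n)

/-- The total module `⨁_s R_{x_s}` of the Čech complex of `x`; its part of degree `i` consists
of the components with `#s = i`. -/
abbrev CechModule (x : Fin l → R) : Type _ := (s : Finset (Fin l)) → CechTerm x s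

/-- The Čech differential, given on components by the alternating sum of the localization maps
`R_{x_{t \ j}} → R_{x_t}`, `j ∈ t`. -/
noncomputable def cechD (x : Fin l → R) : CechModule x →ₗ[R] CechModule x where
  toFun c := fun t => ∑ j ∈ t, indexSign t j • cechRes x (t.erase_subset j) (c (t.erase j))
  map_add' c c' := by
    funext t
    simp [smul_add, Finset.sum_add_distrib]
  map_smul' r c := by
    funext t
    simp only [Pi.smul_apply, map_smul, RingHom.id_apply, Finset.smul_sum]
    exact Finset.sum_congr rfl fun j _ => smul_comm _ _ _

/-- The part `C^i = ⨁_{#s = i} R_{x_s}` of degree `i` of the Čech complex. -/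
def cechDegree (x : Fin l → R) (i : ℕ) : Submodule R (CechModule x) where
  carrier := {c | ∀ s, s.card ≠ i → c s = 0}
  add_mem' hc hc' s hs := by simp [hc s hs, hc' s hs]
  zero_mem' _ _ := rfl
  smul_mem' r c hc s hs := by simp [hc s hs]

/-- Cocycles of degree `i`. -/
noncomputable def cechCocycles (x : Fin l → R) (i : ℕ) : Submodule R (CechModule x) :=
  cechDegree x i ⊓ LinearMap.ker (cechD x)

/-- Coboundaries of degree `i`: the homogeneous elements of degree `i` in the image of the
differential, which raises degrees by one. -/
noncomputable def cechCoboundaries (x : Fin l → R) (i : ℕ) : Submodule R (CechModule x) :=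
  cechDegree x i ⊓ LinearMap.range (cechD x)

/-- The Čech cohomology module `H^i_x(R)`. -/
abbrev CechCohomology (x : Fin l → R) (i : ℕ) : Type _ :=
  ↥(cechCocycles x i) ⧸ (cechCoboundaries x i).submoduleOf (cechCocycles x i)

/-- The Čech differential squares to zero. -/
theorem cechD_cechD (x : Fin l → R) (c : CechModule x) : cechD x (cechD x c) = 0 := by
  have hres : ∀ {s t u : Finset (Fin l)} (h : s ⊆ t) (h' : t ⊆ u) (a : CechTerm x s),
      cechRes x h' (cechRes x h a) = cechRes x (h.trans h') a := by
    intro s t u h h' a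
    have : (cechRes x h').comp (cechRes x h) = cechRes x (h.trans h') :=
      IsLocalization.algHom_ext (Submonoid.powers (∏ j ∈ s, x j)) (Subsingleton.elim _ _)
    exact congrArg (fun f => f a) this
  have hcongr : ∀ {s s' t : Finset (Fin l)} (e : s = s') (h : s ⊆ t) (h' : s' ⊆ t),
      cechRes x h (c s) = cechRes x h' (c s') := by
    rintro s _ t rfl h h'
    rfl
  funext t
  simp only [cechD, LinearMap.coe_mk, AddHom.coe_mk, Pi.zero_apply, map_sum, map_zsmul,
    Finset.smul_sum, hres, smul_smul]
  rw [Finset.sum_sigma']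
  refine Finset.sum_involution (fun p _ => ⟨p.2, p.1⟩) ?_ ?_ ?_ ?_
  · rintro ⟨j, i⟩ h
    simp only [Finset.mem_sigma, Finset.mem_erase] at h
    obtain ⟨hj, hij, hi⟩ := h
    have h1 : t.erase j = insert i ((t.erase j).erase i) :=
      (Finset.insert_erase (Finset.mem_erase.2 ⟨hij, hi⟩)).symm
    have h2 : t.erase i = insert j ((t.erase j).erase i) := by
      rw [Finset.erase_right_comm]
      exact (Finset.insert_erase (Finset.mem_erase.2 ⟨hij.symm, hj⟩)).symm
    have h3 : t = insert j (insert i ((t.erase j).erase i)) := by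
      rw [← h1, Finset.insert_erase hj]
    have hi' : i ∉ (t.erase j).erase i := by simp
    have hj' : j ∉ (t.erase j).erase i := by simp
    have e1 : indexSign t j = indexSign (insert i ((t.erase j).erase i)) j := by
      conv_lhs => rw [h3, indexSign_insert (by simp [hij.symm]), if_neg (lt_irrefl j)]
    have e2 : indexSign t i = indexSign (insert j ((t.erase j).erase i)) i := by
      conv_lhs => rw [h3, Finset.insert_comm, indexSign_insert (by simp [hij]),
        if_neg (lt_irrefl i)]
    have e3 : indexSign (t.erase j) i = indexSign ((t.erase j).erase i) i := by
      conv_lhs => rw [h1, indexSign_insert hi', if_neg (lt_irrefl i)]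
    have e4 : indexSign (t.erase i) j = indexSign ((t.erase j).erase i) j := by
      conv_lhs => rw [h2, indexSign_insert hj', if_neg (lt_irrefl j)]
    have key := indexSign_swap hij hi' hj'
    rw [hcongr (Finset.erase_right_comm (s := t) (a := i) (b := j)) _
      (((t.erase j).erase_subset i).trans (t.erase_subset j)), ← add_smul, e1, e2, e3, e4]
    rw [show _ + _ = (0 : ℤ) by linear_combination key, zero_smul]
  · rintro ⟨j, i⟩ h _ heq
    simp only [Finset.mem_sigma, Finset.mem_erase] at h
    exact h.2.1 (congrArg Sigma.fst heq)
  · rintro ⟨j, i⟩ h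
    simp only [Finset.mem_sigma, Finset.mem_erase] at h ⊢
    exact ⟨h.2.2, fun e => h.2.1 e.symm, h.1⟩
  · rintro ⟨j, i⟩ _
    rfl

end Cech

/-! ### Parameter sequences and Cohen–Macaulay rings in the sense of Hamilton–Marley -/

section HamiltonMarley

variable {R : Type*} [CommRing R] {l : ℕ}

/-- `x = x_1, …, x_l` is a parameter sequence on `R`: it is weakly proregular, `(x)R ≠ R`, and
`H^l_x(R)_p ≠ 0` for every prime ideal `p` containing `(x)R`. -/
structure IsParameterSequence (x : Fin l → R) : Prop where
  weaklyProregular : IsWeaklyProregular x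
  span_ne_top : Ideal.span (Set.range x) ≠ ⊤
  nontrivial_localized : ∀ (p : Ideal R) [p.IsPrime], Ideal.span (Set.range x) ≤ p →
    Nontrivial (LocalizedModule p.primeCompl (CechCohomology x l))

/-- `x = x_1, …, x_l` is a strong parameter sequence on `R`: `x_1, …, x_i` is a parameter
sequence for all `1 ≤ i ≤ l`. -/
def IsStrongParameterSequence (x : Fin l → R) : Prop :=
  ∀ (i : ℕ) (hi : i ≤ l), 1 ≤ i → IsParameterSequence (fun j : Fin i => x (Fin.castLE hi j))

/-- `R` is Cohen–Macaulay in the sense of Hamilton–Marley: every strong parameter sequence on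
`R` is a regular sequence. -/
def IsCohenMacaulayHM (R : Type*) [CommRing R] : Prop :=
  ∀ (l : ℕ), 1 ≤ l → ∀ x : Fin l → R, IsStrongParameterSequence x →
    RingTheory.Sequence.IsRegular R (List.ofFn x)

end HamiltonMarley

/-! ### Quasi-rational plane cones -/

/-- `L ⊆ ℝ²` is an open or closed half plane `{f > 0}` or `{f ≥ 0}` whose boundary line
`{f = 0}` is a rational line (contains a nonzero lattice point). -/
def IsRationalHalfPlane (L : Set (ℝ × ℝ)) : Prop :=
  ∃ f : (ℝ × ℝ) →ₗ[ℝ] ℝ, f ≠ 0 ∧ (∃ v : ℤ × ℤ, v ≠ 0 ∧ f ((v.1 : ℝ), (v.2 : ℝ)) = 0) ∧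
    (L = {x | 0 < f x} ∨ L = {x | 0 ≤ f x})

/-- The monoid `D` consists of the origin and the lattice points of a quasi-rational plane cone,
that is, of the intersection of two open or closed rational half planes. -/
def IsQuasiRationalConeMonoid (D : AddSubmonoid (ℤ × ℤ)) : Prop :=
  ∃ L₁ L₂ : Set (ℝ × ℝ), IsRationalHalfPlane L₁ ∧ IsRationalHalfPlane L₂ ∧
    ∀ v : ℤ × ℤ, v ∈ D ↔ v = 0 ∨ ((v.1 : ℝ), (v.2 : ℝ)) ∈ L₁ ∩ L₂

/-- The extension of monoids `C ⊆ D` is full: a difference of elements of `C` that lies in `D`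
lies in `C`. -/
def IsFullIn (C D : AddSubmonoid (ℤ × ℤ)) : Prop :=
  ∀ a ∈ C, ∀ b ∈ C, a - b ∈ D → a - b ∈ C

/-- The extension of monoids `C ⊆ D` is integral: every element of `D` has a positive multiple
in `C`. -/
def IsIntegralIn (C D : AddSubmonoid (ℤ × ℤ)) : Prop :=
  ∀ d ∈ D, ∃ t : ℕ, 0 < t ∧ t • d ∈ C

/-- `C` is a normal monoid. -/
def IsNormalMonoid (C : AddSubmonoid (ℤ × ℤ)) : Prop :=
  ∀ a ∈ C, ∀ b ∈ C, ∀ t : ℕ, 0 < t → t • (a - b) ∈ C → a - b ∈ C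

/-!
Write `R = k[C]`. Only the condition on the top Čech cohomology of a parameter sequence is needed.
If, for every `n`, some product `t (x_1 ⋯ x_l) ^ m` with `t ∉ p` lies in the ideal
`(x_1 ^ (m + n), …, x_l ^ (m + n))`, then every class of `H^l_x(R)` is killed by an element outside
of `p`, hence `H^l_x(R)_p = 0` (`TopCechVanishesAt.subsingleton`). For a parameter sequence this
must fail at every prime ideal `p ⊇ (x)`.

*Length at least three.* Since `k[ℤ²]` has transcendence degree two, the powers `x_i ^ n` satisfy a
polynomial relation, and its lexicographically least monomial shows that the criterion holds at
every prime ideal (`topCechVanishesAt_of_dependent`). So there are no such parameter sequences.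

*Length at most one.* `R` is a domain, and the entry of a parameter sequence of length one is
nonzero.

*Length two.* Being full in the monoid `D` of the cone, `C` consists of the elements of the lattice
`G = ℤC` that lie in `D`, and `D` is described by two integral linear forms `φ`, `ψ`. The ring
`k[G ∩ {φ ≥ 0}]` is a polynomial or Laurent polynomial ring, hence factorial
(`latticeHalfPlane.uniqueFactorizationMonoid`). Let `B = R[1/w]` be a factorial localization of `R`.
If a prime element `π` of `B` divides `x_0` and `x_1`, then `R` localized at `p = πB ∩ R` is a
discrete valuation ring and the criterion holds at `p`. So the two entries of a parameter sequence
have no common prime factor in `B`, and `x_0 ∣ r x_1` implies `x_0 ∣ r` in `B`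
(`IsParameterSequence.dvd_of_isAwayHom`).

* If both half planes are closed, `R` is the intersection of two such localizations, obtained by
  inverting monomials on the two edges of the cone, so `x_0 ∣ r` in `R`
  (`hasRegularParameterPairs_of_inter`). If the boundary lines are parallel, `R` itself is
  factorial.
* If some half plane is open and `C ≠ 0`, there is a monomial `z` such that the maximal ideal `𝔪` of
  the nontrivial monomials is the radical of `(z)` and `R[1/z]` is factorial. If `x_0` or `x_1` is
  not in `𝔪`, it is coprime to the powers of `z`, and `x_0 ∣ r` descends from `R[1/z]` to `R`. If
  both lie in `𝔪`, then `R[1/z] / (x_0, x_1)` is algebraic over `k`, so a polynomial in `z` with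
  nonzero constant term lies in `(x_0, x_1) R[1/z]`. Hence `(x_0, x_1)` and `(z)` have the same
  radical in `R_𝔪`, and `H^2_x(R)_𝔪 = 0`, which is impossible
  (`IsParameterSequence.dvd_of_augmentation`).
-/

/-! ### The top Čech cohomology at a prime ideal -/

section VanishingCriterion

variable {R : Type*} [CommRing R] {l : ℕ}

/-- An elementary form of the vanishing of `H^l_x(R)_p`: every class `1 / (x_1 ⋯ x_l) ^ n` of the
top Čech cohomology is killed by an element outside of `p`. -/
def TopCechVanishesAt (x : Fin l → R) (p : Ideal R) : Prop :=
  ∀ n : ℕ, ∃ t ∉ p, ∃ m : ℕ, t * (∏ i, x i) ^ m ∈ Ideal.span (Set.range fun i => x i ^ (m + n))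

theorem cechRes_algebraMap (x : Fin l → R) {s t : Finset (Fin l)} (h : s ⊆ t) (a : R) :
    cechRes x h (algebraMap R _ a) = algebraMap R _ a :=
  (cechRes x h).commutes a

theorem cechD_mem_cechDegree (x : Fin l → R) {i : ℕ} {c : CechModule x}
    (hc : c ∈ cechDegree x i) : cechD x c ∈ cechDegree x (i + 1) := by
  intro s hs
  simp only [cechD, LinearMap.coe_mk, AddHom.coe_mk]
  refine Finset.sum_eq_zero fun j hj => ?_
  have : c (s.erase j) = 0 := hc _ (by
    rw [Finset.card_erase_of_mem hj]
    have := Finset.card_pos.2 ⟨j, hj⟩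
    omega)
  rw [this, map_zero, zsmul_zero]

theorem indexSign_mul_self (s : Finset (Fin l)) (j : Fin l) :
    indexSign s j * indexSign s j = 1 := by
  unfold indexSign
  rw [← mul_pow]; simp

/-- In top degree, `(∑ a_i x_i ^ N) / (x_1 ⋯ x_l) ^ N` is the image under the Čech differential
of the family of the fractions `a_i / (∏_{j ≠ i} x_j) ^ N`, up to signs. -/
theorem exists_cechD_eq (x : Fin l → R) (N : ℕ) (a : Fin l → R) (c : CechModule x)
    (hc : c ∈ cechDegree x l)
    (h : algebraMap R (CechTerm x Finset.univ) ((∏ i, x i) ^ N) * c Finset.univ =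
      algebraMap R _ (∑ i, a i * x i ^ N)) :
    ∃ b, cechD x b = c := by
  rcases Nat.eq_zero_or_pos l with rfl | hl
  · refine ⟨0, ?_⟩
    rw [map_zero]
    funext s
    obtain rfl : s = Finset.univ := Subsingleton.elim _ _
    simpa using h.symm
  have hu : ∀ s : Finset (Fin l), IsUnit (algebraMap R (CechTerm x s) (∏ j ∈ s, x j) ^ N) :=
    fun s => (IsLocalization.Away.algebraMap_isUnit (S := CechTerm x s) (∏ j ∈ s, x j)).pow N
  choose u hu using hu
  let b : CechModule x := fun s =>
    ∑ i, if s = Finset.univ.erase i then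
      indexSign Finset.univ i • (algebraMap R (CechTerm x s) (a i) * ((u s)⁻¹ : _ˣ)) else 0
  have hb : b ∈ cechDegree x (l - 1) := by
    intro s hs
    refine Finset.sum_eq_zero fun i _ => if_neg ?_
    rintro rfl
    simp [Finset.card_erase_of_mem] at hs
  refine ⟨b, ?_⟩
  have hDb := cechD_mem_cechDegree x hb
  rw [Nat.sub_add_cancel hl] at hDb
  funext s
  by_cases hs : s.card = l
  swap
  · rw [hDb s hs, hc s hs]
  obtain rfl : s = Finset.univ := Finset.card_eq_iff_eq_univ s |>.1 (by simpa using hs)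
  have hbi : ∀ i : Fin l, b (Finset.univ.erase i) = indexSign Finset.univ i •
      (algebraMap R (CechTerm x (Finset.univ.erase i)) (a i) *
        ((u (Finset.univ.erase i))⁻¹ : _ˣ)) := by
    intro i
    simp only [b]
    rw [Finset.sum_eq_single i]
    · simp
    · intro j _ hj
      refine if_neg fun e => hj ?_
      by_contra hne
      have : j ∈ Finset.univ.erase i := by simp [hne]
      rw [e] at this
      simp at this
    · simp
  have hunit : IsUnit (algebraMap R (CechTerm x Finset.univ) ((∏ i, x i) ^ N)) := by
    rw [map_pow, ← hu]; exact (u _).isUnit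
  refine hunit.mul_left_cancel ?_
  rw [h]
  simp only [cechD, LinearMap.coe_mk, AddHom.coe_mk, Finset.mul_sum, map_sum]
  refine Finset.sum_congr rfl fun i _ => ?_
  rw [hbi, map_zsmul, smul_smul, indexSign_mul_self, one_smul, map_mul, cechRes_algebraMap]
  have h1 : algebraMap R (CechTerm x Finset.univ) ((∏ j, x j) ^ N) =
      algebraMap R _ (x i ^ N) * algebraMap R _ (∏ j ∈ Finset.univ.erase i, x j) ^ N := by
    rw [← map_pow, ← map_mul, ← mul_pow, Finset.mul_prod_erase _ _ (Finset.mem_univ i)]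
  have h2 : algebraMap R (CechTerm x Finset.univ) (∏ j ∈ Finset.univ.erase i, x j) ^ N *
      cechRes x (Finset.univ.erase_subset i) ((u (Finset.univ.erase i))⁻¹ : _ˣ) = 1 := by
    rw [← cechRes_algebraMap x (Finset.univ.erase_subset i), ← map_pow, ← hu, ← map_mul,
      Units.mul_inv, map_one]
  rw [h1, map_mul]
  linear_combination (algebraMap R (CechTerm x Finset.univ) (x i ^ N) *
    algebraMap R (CechTerm x Finset.univ) (a i)) * h2

theorem TopCechVanishesAt.subsingleton {x : Fin l → R} {p : Ideal R} [p.IsPrime]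
    (h : TopCechVanishesAt x p) :
    Subsingleton (LocalizedModule p.primeCompl (CechCohomology x l)) := by
  refine LocalizedModule.subsingleton_iff.2 fun ξ => ?_
  obtain ⟨⟨c, hc⟩, rfl⟩ := Submodule.Quotient.mk_surjective _ ξ
  obtain ⟨n, a, hna⟩ := IsLocalization.Away.surj (∏ j, x j) (c Finset.univ)
  obtain ⟨t, ht, m, hm⟩ := h n
  refine ⟨t, ht, ?_⟩
  rw [← Submodule.Quotient.mk_smul, Submodule.Quotient.mk_eq_zero]
  change t • c ∈ cechCoboundaries x l
  have htc : t • c ∈ cechDegree x l := Submodule.smul_mem _ _ hc.1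
  obtain ⟨f, hf⟩ := (Ideal.mem_span_range_iff_exists_fun).1 hm
  refine ⟨htc, exists_cechD_eq x (m + n) (fun i => a * f i) _ htc ?_⟩
  have : ∑ i, a * f i * x i ^ (m + n) = a * (t * (∏ i, x i) ^ m) := by
    rw [← hf, Finset.mul_sum]
    exact Finset.sum_congr rfl fun i _ => by ring
  rw [this, Pi.smul_apply, Algebra.smul_def, pow_add]
  simp only [map_mul, map_pow] at hna ⊢
  rw [← hna]
  ring

theorem IsParameterSequence.not_topCechVanishesAt {x : Fin l → R} (hx : IsParameterSequence x)
    (p : Ideal R) [hp : p.IsPrime] (hxp : ∀ i, x i ∈ p) : ¬ TopCechVanishesAt x p := by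
  intro h
  have h1 := h.subsingleton
  have h2 := hx.nontrivial_localized p (Ideal.span_le.2 (by rintro _ ⟨i, rfl⟩; exact hxp i))
  exact not_subsingleton _ h1

theorem IsParameterSequence.not_forall_topCechVanishesAt {x : Fin l → R}
    (hx : IsParameterSequence x) :
    ¬ ∀ (p : Ideal R) [p.IsPrime], TopCechVanishesAt x p := by
  intro h
  obtain ⟨p, hp, hxp⟩ := Ideal.exists_le_maximal _ hx.span_ne_top
  exact hx.not_topCechVanishesAt p (fun i => hxp (Ideal.subset_span ⟨i, rfl⟩)) (h p)

theorem IsParameterSequence.prod_ne_zero {x : Fin l → R} (hx : IsParameterSequence x) :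
    ∏ i, x i ≠ 0 := by
  intro h
  refine hx.not_forall_topCechVanishesAt fun p hp n => ⟨1, ?_, 1, ?_⟩
  · exact (Ideal.ne_top_iff_one _).1 hp.ne_top
  · simp [h]

end VanishingCriterion

/-! ### Algebraic dependence -/

section AlgebraicDependence

variable {k R : Type*} [Field k] [CommRing R] [Algebra k R] {l : ℕ}

/-- If `F ≠ 0` is a relation between the `x_i` and `x ^ α` is its lexicographically least monomial,
then every other monomial of `F` is divisible by some `x_i ^ (α_i + 1)`. -/
theorem exists_prod_pow_mem_span_of_aeval_eq_zero (x : Fin l → R) {F : MvPolynomial (Fin l) k}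
    (hF : F ≠ 0) (h : MvPolynomial.aeval x F = 0) :
    ∃ α : Fin l → ℕ, ∏ i, x i ^ α i ∈ Ideal.span (Set.range fun i => x i ^ (α i + 1)) := by
  obtain ⟨α, hα, hmin⟩ := Finset.exists_min_image F.support
    (fun β => toLex β) (MvPolynomial.support_nonempty.2 hF)
  refine ⟨α, ?_⟩
  rw [MvPolynomial.aeval_def, MvPolynomial.eval₂_eq', ← Finset.add_sum_erase _ _ hα] at h
  have hunit : IsUnit (algebraMap k R (F.coeff α)) :=
    (isUnit_iff_ne_zero.2 (MvPolynomial.mem_support_iff.1 hα)).map _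
  rw [← Ideal.unit_mul_mem_iff_mem _ hunit, eq_neg_of_add_eq_zero_left h]
  refine neg_mem (Ideal.sum_mem _ fun β hβ => Ideal.mul_mem_left _ _ ?_)
  obtain ⟨hne, hβ⟩ := Finset.mem_erase.1 hβ
  have hlt : toLex α < toLex β := lt_of_le_of_ne (hmin β hβ) fun e => hne (toLex.injective e).symm
  obtain ⟨i, -, hi⟩ := Finsupp.Lex.lt_iff.1 hlt
  refine Ideal.mem_of_dvd _ ?_ (Ideal.subset_span ⟨i, rfl⟩)
  exact (pow_dvd_pow _ (Nat.succ_le_of_lt hi)).trans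
    (Finset.dvd_prod_of_mem (fun i => x i ^ β i) (Finset.mem_univ i))

theorem topCechVanishesAt_of_dependent (x : Fin l → R)
    (h : ∀ y : Fin l → R, ¬ AlgebraicIndependent k y) (p : Ideal R) [hp : p.IsPrime] :
    TopCechVanishesAt x p := by
  intro n
  refine ⟨1, (Ideal.ne_top_iff_one _).1 hp.ne_top, ?_⟩
  have h1 := h (fun i => x i ^ n)
  rw [algebraicIndependent_iff] at h1
  push Not at h1
  obtain ⟨F, hF0, hF⟩ := h1
  obtain ⟨α, hα⟩ := exists_prod_pow_mem_span_of_aeval_eq_zero _ hF hF0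
  obtain ⟨M, hM⟩ : ∃ M, ∀ i, α i ≤ M :=
    ⟨∑ i, α i, fun i => Finset.single_le_sum (f := α) (by simp) (Finset.mem_univ i)⟩
  refine ⟨n * M, ?_⟩
  obtain ⟨f, hf⟩ := (Ideal.mem_span_range_iff_exists_fun).1 hα
  have e : (∏ i, x i) ^ (n * M) = (∏ i, (x i ^ n) ^ α i) * ∏ i, x i ^ (n * (M - α i)) := by
    rw [← Finset.prod_pow, ← Finset.prod_mul_distrib]
    refine Finset.prod_congr rfl fun i _ => ?_
    rw [← pow_mul, ← pow_add, ← mul_add, Nat.add_sub_cancel' (hM i)]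
  rw [one_mul, e, ← hf, Finset.sum_mul]
  refine Ideal.sum_mem _ fun i _ => ?_
  rw [← Finset.mul_prod_erase _ _ (Finset.mem_univ i)]
  have e2 : x i ^ (n * M + n) = (x i ^ n) ^ (α i + 1) * x i ^ (n * (M - α i)) := by
    rw [← pow_mul, ← pow_add, mul_add, mul_one, add_right_comm, ← mul_add,
      Nat.add_sub_cancel' (hM i)]
  have e3 : x i ^ (n * M + n) ∈ Ideal.span (Set.range fun i => x i ^ (n * M + n)) :=
    Ideal.subset_span ⟨i, rfl⟩
  convert Ideal.mul_mem_left _ (f i * ∏ j ∈ Finset.univ.erase i, x j ^ (n * (M - α j))) e3 using 1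
  rw [e2]
  ring

theorem not_algebraicIndependent_of_trdeg_le (h : Algebra.trdeg k R ≤ 2) (hl : 3 ≤ l)
    (y : Fin l → R) : ¬ AlgebraicIndependent k y := by
  intro hy
  have h1 := hy.lift_cardinalMk_le_trdeg
  have h2 : (l : Cardinal.{0}) ≤ 2 := by
    simpa using h1.trans (Cardinal.lift_le.2 h)
  have : l ≤ 2 := by exact_mod_cast h2
  omega

/-- After cancelling powers of `b` in a relation `F(b) = 0`, the constant term is nonzero and
divisible by `b`. -/
theorem exists_dvd_of_eval₂_eq_zero {A B : Type*} [CommRing A] [CommRing B] [IsDomain B]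
    (φ : A →+* B) {b : B} (hb : b ≠ 0) {F : Polynomial A} (hF : F ≠ 0) (h : F.eval₂ φ b = 0) :
    ∃ a : A, a ≠ 0 ∧ b ∣ φ a := by
  obtain ⟨G, hG, hGc⟩ := Polynomial.exists_eq_pow_rootMultiplicity_mul_and_not_dvd F hF 0
  rw [Polynomial.C_0, sub_zero] at hG hGc
  rw [Polynomial.X_dvd_iff] at hGc
  refine ⟨G.coeff 0, hGc, ?_⟩
  rw [hG, Polynomial.eval₂_mul, Polynomial.eval₂_X_pow] at h
  have h1 : G.eval₂ φ b = 0 := (mul_eq_zero.1 h).resolve_left (pow_ne_zero _ hb)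
  rw [← Polynomial.divX_mul_X_add G, Polynomial.eval₂_add, Polynomial.eval₂_mul,
    Polynomial.eval₂_X, Polynomial.eval₂_C] at h1
  exact ⟨-(G.divX.eval₂ φ b), by linear_combination h1⟩

theorem exists_dvd_aeval_of_dependent {B : Type*} [CommRing B] [IsDomain B] [Algebra k B]
    {n : ℕ} {y : Fin (n + 1) → B} (hy : y 0 ≠ 0) (h : ¬ AlgebraicIndependent k y) :
    ∃ F : MvPolynomial (Fin n) k, F ≠ 0 ∧ y 0 ∣ MvPolynomial.aeval (fun i => y i.succ) F := by
  rw [algebraicIndependent_iff] at h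
  push Not at h
  obtain ⟨F, hF0, hF⟩ := h
  have key : ((MvPolynomial.finSuccEquiv k n F).eval₂
      (MvPolynomial.aeval (R := k) (fun i : Fin n => y i.succ)).toRingHom (y 0)) = 0 := by
    rw [← hF0]
    have : (Polynomial.eval₂RingHom
        (MvPolynomial.aeval (R := k) (fun i : Fin n => y i.succ)).toRingHom (y 0)).comp
        (MvPolynomial.finSuccEquiv k n).toRingEquiv.toRingHom =
        (MvPolynomial.aeval (R := k) y).toRingHom := by
      refine MvPolynomial.ringHom_ext (fun r => ?_) fun i => ?_
      · simp [MvPolynomial.finSuccEquiv_apply]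
      · refine Fin.cases ?_ (fun i => ?_) i <;> simp [MvPolynomial.finSuccEquiv_apply]
    exact congrArg (fun f => f F) this
  exact exists_dvd_of_eval₂_eq_zero _ hy
    ((map_ne_zero_iff _ (MvPolynomial.finSuccEquiv k n).injective).2 hF) key

/-- Modulo a prime element `π`, two elements `z` and `y` are algebraically dependent, and after
cancelling powers of `y` a relation yields a polynomial in `z` alone. -/
theorem exists_aeval_mem_span_pair_of_prime {B : Type*} [CommRing B] [IsDomain B] [Algebra k B]
    (hB : Algebra.trdeg k B ≤ 2) (z : B) {π y : B} (hπ : Prime π) (hy : ¬ π ∣ y) :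
    ∃ q : Polynomial k, q ≠ 0 ∧ Polynomial.aeval z q ∈ Ideal.span {π, y} := by
  obtain ⟨F, hF, hd⟩ := exists_dvd_aeval_of_dependent (k := k) (y := ![π, y, z]) hπ.ne_zero
    (not_algebraicIndependent_of_trdeg_le hB le_rfl _)
  have hprime : (Ideal.span {π}).IsPrime := (Ideal.span_singleton_prime hπ.ne_zero).2 hπ
  let ψ : B →ₐ[k] B ⧸ Ideal.span {π} := Ideal.Quotient.mkₐ k _
  have hψ : ∀ b, ψ b = 0 ↔ π ∣ b := fun b => by
    rw [← Ideal.mem_span_singleton]; exact Ideal.Quotient.eq_zero_iff_mem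
  have hdep : ¬ AlgebraicIndependent k ![ψ y, ψ z] := by
    intro hi
    refine hF ((algebraicIndependent_iff.1 hi) F ?_)
    have : (fun i => ψ ((![π, y, z] : Fin 3 → B) i.succ)) = ![ψ y, ψ z] := by
      funext i; fin_cases i <;> rfl
    rw [← this]
    have h2 := (hψ _).2 hd
    rwa [MvPolynomial.comp_aeval_apply] at h2
  obtain ⟨G, hG, hGd⟩ := exists_dvd_aeval_of_dependent (k := k) (y := ![ψ y, ψ z])
    (by simpa [hψ] using hy) hdep
  obtain ⟨q, rfl⟩ := (MvPolynomial.uniqueAlgEquiv k (Fin 1)).symm.surjective G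
  refine ⟨q, fun e => hG (by rw [e, map_zero]), ?_⟩
  have hq : MvPolynomial.aeval (fun i : Fin 1 => (![ψ y, ψ z] : Fin 2 → _) i.succ)
      ((MvPolynomial.uniqueAlgEquiv k (Fin 1)).symm q) = ψ (Polynomial.aeval z q) := by
    have : ((MvPolynomial.aeval (fun i : Fin 1 => (![ψ y, ψ z] : Fin 2 → _) i.succ)).comp
        (MvPolynomial.uniqueAlgEquiv k (Fin 1)).symm.toAlgHom) =
        ψ.comp (Polynomial.aeval z) := by
      ext
      simp
    exact congrArg (fun f => f q) this
  rw [hq] at hGd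
  obtain ⟨c, hc⟩ := hGd
  obtain ⟨c, rfl⟩ := Ideal.Quotient.mk_surjective c
  have : ψ (Polynomial.aeval z q - y * c) = 0 := by
    rw [map_sub, map_mul, hc]; exact sub_self _
  obtain ⟨d, hd⟩ := (hψ _).1 this
  exact Ideal.mem_span_pair.2 ⟨d, c, by linear_combination -hd⟩

/-- If `x` and `y` have no common prime factor in a factorial ring of transcendence degree at most
two, then every element `z` is algebraic over `k` modulo `(x, y)`. -/
theorem exists_aeval_mem_span_pair {B : Type*} [CommRing B] [IsDomain B] [Algebra k B]
    [UniqueFactorizationMonoid B] (hB : Algebra.trdeg k B ≤ 2) (z : B) {x y : B} (hx : x ≠ 0)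
    (hxy : ∀ π : B, Prime π → π ∣ x → ¬ π ∣ y) :
    ∃ q : Polynomial k, q ≠ 0 ∧ Polynomial.aeval z q ∈ Ideal.span {x, y} := by
  induction x using UniqueFactorizationMonoid.induction_on_prime with
  | h₁ => exact absurd rfl hx
  | h₂ u hu => exact ⟨1, one_ne_zero, by
      rw [map_one, (Ideal.eq_top_of_isUnit_mem _ (Ideal.subset_span (Set.mem_insert _ _)) hu)]
      exact Submodule.mem_top⟩
  | h₃ a π ha hπ ih =>
    obtain ⟨q₁, hq₁, h₁⟩ := ih ha fun π' hπ' hd => hxy π' hπ' (hd.mul_left _)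
    obtain ⟨q₂, hq₂, h₂⟩ := exists_aeval_mem_span_pair_of_prime hB z hπ
      (hxy π hπ (dvd_mul_right _ _))
    refine ⟨q₁ * q₂, mul_ne_zero hq₁ hq₂, ?_⟩
    rw [map_mul]
    obtain ⟨c₁, d₁, h₁⟩ := Ideal.mem_span_pair.1 h₁
    obtain ⟨c₂, d₂, h₂⟩ := Ideal.mem_span_pair.1 h₂
    rw [← h₁, ← h₂]
    exact Ideal.mem_span_pair.2 ⟨c₁ * c₂, d₁ * (c₂ * π + d₂ * y) + c₁ * a * d₂, by ring⟩

end AlgebraicDependence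

/-! ### Factorial principal localizations -/

section PrincipalLocalization

/-- `j : R → B` exhibits the ring `B` as the localization `R[1/w]`, for an element `w` that is
not a zero divisor. -/
structure IsAwayHom {R B : Type*} [CommRing R] [CommRing B] (j : R →+* B) (w : R) : Prop where
  injective : Function.Injective j
  isUnit : IsUnit (j w)
  exists_pow_mul : ∀ b : B, ∃ (N : ℕ) (r : R), j r = j w ^ N * b

variable {R B : Type*} [CommRing R] [CommRing B] [IsDomain B] [UniqueFactorizationMonoid B]
  {j : R →+* B} {w : R}

/-- If a prime element `π` of `B = R[1/w]` divides `x_0 = π ^ a u` and `x_1 = π ^ b v`, then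
`R_p = B_(π)` is a discrete valuation ring for the prime ideal `p = πB ∩ R`. The vanishing of
`H^2_x(R)_p` is read off from the identity `x_1 ^ (an) u ^ (bn) = x_0 ^ (bn) v ^ (an)`. -/
theorem IsAwayHom.topCechVanishesAt_comap (hj : IsAwayHom j w) {x : Fin 2 → R}
    (hx : ∀ i, x i ≠ 0) {π : B} (hπ : Prime π) (hd : ∀ i, π ∣ j (x i)) :
    TopCechVanishesAt x ((Ideal.span {π}).comap j) := by
  have hjx : ∀ i, j (x i) ≠ 0 := fun i => (map_ne_zero_iff j hj.injective).2 (hx i)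
  intro n
  obtain ⟨a, u, hu, hau⟩ := WfDvdMonoid.max_power_factor (hjx 0) hπ.irreducible
  obtain ⟨b, v, hv, hbv⟩ := WfDvdMonoid.max_power_factor (hjx 1) hπ.irreducible
  have hb : 1 ≤ b := by
    by_contra h0
    obtain rfl : b = 0 := by omega
    rw [pow_zero, one_mul] at hbv
    exact hv (hbv ▸ hd 1)
  obtain ⟨N₁, t, ht⟩ := hj.exists_pow_mul (u ^ (b * n))
  obtain ⟨N₂, c, hc⟩ := hj.exists_pow_mul (v ^ (a * n))
  refine ⟨w ^ N₂ * t, ?_, a * n, ?_⟩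
  · rw [Ideal.mem_comap, Ideal.mem_span_singleton, map_mul, ht, map_pow, ← mul_assoc,
      ((hj.isUnit.pow N₂).mul (hj.isUnit.pow N₁)).dvd_mul_left]
    exact fun h => hu (hπ.dvd_of_dvd_pow h)
  · have key : w ^ N₂ * t * (∏ i, x i) ^ (a * n) =
        w ^ N₁ * c * x 0 ^ (b * n - n) * x 0 ^ (a * n + n) := by
      have hbn : b * n - n + (a * n + n) = a * n + b * n := by
        have : n ≤ b * n := Nat.le_mul_of_pos_left n hb
        omega
      rw [mul_assoc _ (x 0 ^ _), ← pow_add, hbn, Fin.prod_univ_two]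
      refine hj.injective ?_
      simp only [map_mul, map_pow, ht, hc]
      have e : j (x 1) ^ (a * n) * u ^ (b * n) = j (x 0) ^ (b * n) * v ^ (a * n) := by
        rw [hau, hbv]; ring
      rw [mul_pow, pow_add]
      linear_combination (j w ^ N₂ * j w ^ N₁ * j (x 0) ^ (a * n)) * e
    rw [key]
    exact Ideal.mul_mem_left _ _ (Ideal.subset_span ⟨0, rfl⟩)

theorem IsParameterSequence.not_dvd_of_isAwayHom (hj : IsAwayHom j w) {x : Fin 2 → R}
    (hx : IsParameterSequence x) (hx0 : ∀ i, x i ≠ 0) {π : B} (hπ : Prime π)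
    (h0 : π ∣ j (x 0)) : ¬ π ∣ j (x 1) := by
  intro h1
  have hd : ∀ i, π ∣ j (x i) := by
    intro i; fin_cases i <;> assumption
  have : (Ideal.span {π}).IsPrime := (Ideal.span_singleton_prime hπ.ne_zero).2 hπ
  refine hx.not_topCechVanishesAt ((Ideal.span {π}).comap j) (fun i => ?_)
    (hj.topCechVanishesAt_comap hx0 hπ hd)
  exact Ideal.mem_span_singleton.2 (hd i)

theorem IsParameterSequence.dvd_of_isAwayHom (hj : IsAwayHom j w) {x : Fin 2 → R}
    (hx : IsParameterSequence x) (hx0 : ∀ i, x i ≠ 0) {r : R} (h : x 0 ∣ r * x 1) :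
    j (x 0) ∣ j r := by
  refine UniqueFactorizationMonoid.dvd_of_dvd_mul_left_of_no_prime_factors
    ((map_ne_zero_iff j hj.injective).2 (hx0 0)) ?_ (by simpa using map_dvd j h)
  exact fun π h0 h1 hπ => hx.not_dvd_of_isAwayHom hj hx0 hπ h0 h1

end PrincipalLocalization

/-! ### Maximal ideals that are radicals of principal ideals -/

section Augmentation

variable {k R B : Type*} [Field k] [CommRing R] [Algebra k R] [CommRing B] [IsDomain B]
  [UniqueFactorizationMonoid B] [Algebra k B] {j : R →ₐ[k] B} {z : R} {ε : R →ₐ[k] k}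

/-- If `ε(r) ≠ 0`, then `r` and a power of `z` generate the unit ideal. -/
theorem exists_dvd_sub_of_augmentation_ne_zero
    (hrad : ∀ a, ε a = 0 → ∃ n, z ∣ a ^ n) {r : R} (hr : ε r ≠ 0) (N : ℕ) :
    ∃ d e, r * d + z ^ N * e = 1 := by
  have h0 : ε (r - algebraMap k R (ε r)) = 0 := by simp
  obtain ⟨n, hn⟩ := hrad _ h0
  have hu : IsUnit (algebraMap k R (ε r)) := (isUnit_iff_ne_zero.2 hr).map _
  have h1 : IsCoprime r (r - algebraMap k R (ε r)) := by
    obtain ⟨v, hv⟩ := hu.exists_right_inv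
    exact ⟨v, -v, by linear_combination hv⟩
  have h2 : IsCoprime r z := (h1.pow_right (n := n)).of_isCoprime_of_dvd_right hn
  obtain ⟨d, e, h⟩ := h2.pow_right (n := N)
  exact ⟨d, e, by linear_combination h⟩

/-- Suppose that `x` and `y` have no common prime factor in `B = R[1/z]`, a factorial ring of
transcendence degree at most two. Then `(x, y)` contains the product of an element outside of
`ker ε`, a polynomial in `z` with nonzero constant term, and a power of `z`. -/
theorem exists_mul_pow_mem_span_pair (hj : IsAwayHom j.toRingHom z)
    (hB : Algebra.trdeg k B ≤ 2) (hz : ε z = 0) {x y : R} (hx : x ≠ 0)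
    (hxy : ∀ π : B, Prime π → π ∣ j x → ¬ π ∣ j y) :
    ∃ t, ε t ≠ 0 ∧ ∃ N, t * z ^ N ∈ Ideal.span {x, y} := by
  obtain ⟨q, hq, hmem⟩ := exists_aeval_mem_span_pair hB (j z)
    ((map_ne_zero_iff j hj.injective).2 hx) hxy
  obtain ⟨G, hG, hGc⟩ := Polynomial.exists_eq_pow_rootMultiplicity_mul_and_not_dvd q hq 0
  rw [Polynomial.C_0, sub_zero] at hG hGc
  rw [Polynomial.X_dvd_iff] at hGc
  refine ⟨Polynomial.aeval z G, ?_, ?_⟩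
  · rw [← Polynomial.aeval_algHom_apply, hz]
    simpa [Polynomial.aeval_def, ← Polynomial.coeff_zero_eq_eval_zero] using hGc
  · have hu : IsUnit (j z) := hj.isUnit
    rw [hG, map_mul, map_pow, Polynomial.aeval_X, Ideal.unit_mul_mem_iff_mem _ (hu.pow _)] at hmem
    obtain ⟨c, d, hcd⟩ := Ideal.mem_span_pair.1 hmem
    obtain ⟨N₁, c', hc'⟩ := hj.exists_pow_mul c
    obtain ⟨N₂, d', hd'⟩ := hj.exists_pow_mul d
    refine ⟨N₁ + N₂, Ideal.mem_span_pair.2 ⟨z ^ N₂ * c', z ^ N₁ * d', hj.injective ?_⟩⟩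
    change j _ = j _
    change j c' = j z ^ N₁ * c at hc'
    change j d' = j z ^ N₂ * d at hd'
    rw [map_mul, map_pow, ← Polynomial.aeval_algHom_apply, ← hcd]
    simp only [map_add, map_mul, map_pow, hc', hd']
    ring

/-- If `(x_0, x_1)` and `(z)` have the same radical after inverting an element `t` outside of `p`,
then `D(x_0) ∪ D(x_1) = D(z)` is affine near `p`, so that `H^2_x(R)_p = 0`. -/
theorem topCechVanishesAt_of_radical_eq {R : Type*} [CommRing R] {p : Ideal R} [p.IsPrime]
    {x : Fin 2 → R} {z t : R} (ht : t ∉ p) {N : ℕ} (htz : t * z ^ N ∈ Ideal.span {x 0, x 1})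
    (hz : ∀ i, ∃ n, z ∣ x i ^ n) : TopCechVanishesAt x p := by
  intro n
  obtain ⟨a, b, hab⟩ := Ideal.mem_span_pair.1 htz
  -- the `2n`-th power of `t z ^ N` lies in `(x_0 ^ n, x_1 ^ n)`
  obtain ⟨c, d, hcd⟩ : ∃ c d, c * x 0 ^ n + d * x 1 ^ n = t ^ (2 * n) * (z ^ N) ^ (2 * n) := by
    refine Ideal.mem_span_pair.1 ?_
    rw [← mul_pow, ← hab]
    refine Ideal.add_pow_mem_of_pow_mem_of_le (m := n) (n := n) _ ?_ ?_ (by omega) <;>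
    · rw [mul_pow]
      exact Ideal.mul_mem_left _ _ (Ideal.subset_span (by simp))
  choose e he using hz
  obtain ⟨M, hM⟩ : ∃ M, ∀ i, (z ^ N) ^ (2 * n) ∣ x i ^ M := by
    refine ⟨(e 0 + e 1) * (N * (2 * n)), fun i => ?_⟩
    rw [← pow_mul z, pow_mul (x i)]
    refine pow_dvd_pow_of_dvd ((he i).trans (pow_dvd_pow _ ?_)) _
    fin_cases i <;> simp
  obtain ⟨f, hf⟩ := hM 0
  obtain ⟨g, hg⟩ := hM 1
  refine ⟨t ^ (2 * n), fun h => ht (‹p.IsPrime›.mem_of_pow_mem _ h), M, ?_⟩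
  have key : t ^ (2 * n) * (∏ i, x i) ^ M =
      (g * c) * x 0 ^ (M + n) + (f * d) * x 1 ^ (M + n) := by
    rw [Fin.prod_univ_two, mul_pow, pow_add, pow_add]
    linear_combination -(x 0 ^ M * g) * hcd + t ^ (2 * n) * x 0 ^ M * hg +
      (d * x 1 ^ n) * (g * hf - f * hg)
  rw [key]
  exact add_mem (Ideal.mul_mem_left _ _ (Ideal.subset_span ⟨0, rfl⟩))
    (Ideal.mul_mem_left _ _ (Ideal.subset_span ⟨1, rfl⟩))

/-- Suppose that `ker ε` is the radical of `(z)`, and that `R[1/z]` is a factorial ring of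
transcendence degree at most two. Then no parameter sequence of length two lies in `ker ε`, and if
`x_0` or `x_1` lies outside of `ker ε`, divisibility by `x_0` descends from `R[1/z]` to `R`. -/
theorem IsParameterSequence.dvd_of_augmentation (hj : IsAwayHom j.toRingHom z)
    (hB : Algebra.trdeg k B ≤ 2) (hz : ε z = 0) (hrad : ∀ a, ε a = 0 → ∃ n, z ∣ a ^ n)
    {x : Fin 2 → R} (hx : IsParameterSequence x) (hx0 : ∀ i, x i ≠ 0) {r : R}
    (h : x 0 ∣ r * x 1) : x 0 ∣ r := by
  have : IsDomain R := hj.injective.isDomain j.toRingHom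
  obtain ⟨b, hb⟩ := hx.dvd_of_isAwayHom hj hx0 h
  obtain ⟨N, c, hc⟩ := hj.exists_pow_mul b
  have hrc : r * z ^ N = x 0 * c := hj.injective (by
    rw [map_mul, map_mul, hb, hc, map_pow]; ring)
  obtain ⟨s, hs⟩ := h
  -- now `x_0` divides `r z ^ N`, and `r x_1`
  by_cases h0 : ε (x 0) = 0
  swap
  · obtain ⟨d, e, hde⟩ := exists_dvd_sub_of_augmentation_ne_zero hrad h0 N
    exact ⟨r * d + c * e, by linear_combination -r * hde + e * hrc⟩
  by_cases h1 : ε (x 1) = 0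
  swap
  · obtain ⟨d, e, hde⟩ := exists_dvd_sub_of_augmentation_ne_zero hrad h1 N
    exact ⟨s * d + c * e, by linear_combination -r * hde + e * hrc + d * hs⟩
  have hp : (RingHom.ker ε).IsPrime := RingHom.ker_isPrime _
  have hxε : ∀ i, ε (x i) = 0 := by
    intro i; fin_cases i <;> assumption
  obtain ⟨t, ht, N, htz⟩ := exists_mul_pow_mem_span_pair hj hB hz (hx0 0)
    (fun π hπ => hx.not_dvd_of_isAwayHom hj hx0 hπ) (y := x 1)
  exact absurd (topCechVanishesAt_of_radical_eq (p := RingHom.ker ε) ht htz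
    fun i => hrad _ (hxε i)) (hx.not_topCechVanishesAt _ hxε)

end Augmentation

/-! ### Regular sequences -/

section RegularSequences

variable {R : Type*} [CommRing R]

/-- `x_0, x_1` is a regular sequence for all parameter sequences of length two with nonzero
entries, apart from the condition `(x_0, x_1) ≠ R`. -/
def HasRegularParameterPairs (R : Type*) [CommRing R] : Prop :=
  ∀ x : Fin 2 → R, IsParameterSequence x → (∀ i, x i ≠ 0) → ∀ r, x 0 ∣ r * x 1 → x 0 ∣ r

theorem IsParameterSequence.isRegular_of_le_two [IsDomain R] {l : ℕ} {x : Fin l → R}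
    (hx : IsParameterSequence x) (hl : l ≤ 2)
    (h2 : HasRegularParameterPairs R) :
    RingTheory.Sequence.IsRegular R (List.ofFn x) := by
  have hx0 : ∀ i, x i ≠ 0 := fun i =>
    Finset.prod_ne_zero_iff.1 hx.prod_ne_zero i (Finset.mem_univ i)
  refine ⟨?_, ?_⟩
  · interval_cases l
    · simp
    · have : List.ofFn x = [x 0] := by simp
      rw [this, RingTheory.Sequence.isWeaklyRegular_singleton_iff]
      exact IsSMulRegular.of_ne_zero (hx0 0)
    · have : List.ofFn x = [x 0, x 1] := by simp
      rw [this, RingTheory.Sequence.isWeaklyRegular_cons_iff,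
        RingTheory.Sequence.isWeaklyRegular_singleton_iff]
      refine ⟨IsSMulRegular.of_ne_zero (hx0 0), ?_⟩
      rw [isSMulRegular_quotient_iff_mem_of_smul_mem]
      intro r hr
      rw [Submodule.mem_smul_pointwise_iff_exists] at hr ⊢
      obtain ⟨s, -, hs⟩ := hr
      obtain ⟨c, hc⟩ := h2 x hx hx0 r ⟨s, by
        rw [mul_comm r]; simpa [smul_eq_mul] using hs.symm⟩
      exact ⟨c, Submodule.mem_top, hc.symm⟩
  · have : Ideal.ofList (List.ofFn x) = Ideal.span (Set.range x) := by
      rw [Ideal.ofList]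
      congr 1
      ext a
      simp [List.mem_ofFn]
    rw [this, smul_eq_mul, Ideal.mul_top]
    exact hx.span_ne_top.symm

end RegularSequences

/-! ### Factorial monoid algebras -/

section FactorialMonoidAlgebras

variable (k : Type*) [Field k]

theorem AddMonoidAlgebra.isDomain_of_injective {M N : Type*} [AddCommMonoid M] [AddCommMonoid N]
    [IsDomain (AddMonoidAlgebra k N)] (f : M →+ N) (hf : Function.Injective f) :
    IsDomain (AddMonoidAlgebra k M) :=
  Function.Injective.isDomain (AddMonoidAlgebra.mapDomainAlgHom k k f).toRingHom
    (AddMonoidAlgebra.mapDomain_injective hf)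

instance AddSubmonoid.isDomain_addMonoidAlgebra (E : AddSubmonoid (ℤ × ℤ)) :
    IsDomain (AddMonoidAlgebra k E) :=
  AddMonoidAlgebra.isDomain_of_injective k E.subtype E.subtype_injective

theorem AddMonoidAlgebra.uniqueFactorizationMonoid_int_prod (M : Type*) [AddCommMonoid M]
    [IsDomain (AddMonoidAlgebra k M)] [UniqueFactorizationMonoid (AddMonoidAlgebra k M)] :
    UniqueFactorizationMonoid (AddMonoidAlgebra k (ℤ × M)) :=
  (AddMonoidAlgebra.curryRingEquiv (R := k)
    (M := ℤ) (N := M)).symm.toMulEquiv.uniqueFactorizationMonoid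
    (UniqueFactorizationMonoid.of_isLocalization
      (Submonoid.powers (Polynomial.X : Polynomial (AddMonoidAlgebra k M)))
      (LaurentPolynomial (AddMonoidAlgebra k M)))

theorem AddMonoidAlgebra.uniqueFactorizationMonoid_nat_prod (M : Type*) [AddCommMonoid M]
    [IsDomain (AddMonoidAlgebra k M)] [UniqueFactorizationMonoid (AddMonoidAlgebra k M)] :
    UniqueFactorizationMonoid (AddMonoidAlgebra k (ℕ × M)) :=
  ((AddMonoidAlgebra.curryRingEquiv (R := k) (M := ℕ) (N := M)).trans
    (Polynomial.toFinsuppIso _).symm).symm.toMulEquiv.uniqueFactorizationMonoid inferInstance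

variable {k} in
theorem AddMonoidAlgebra.uniqueFactorizationMonoid_congr {M N : Type*} [AddCommMonoid M]
    [AddCommMonoid N] (e : M ≃+ N) (h : UniqueFactorizationMonoid (AddMonoidAlgebra k M)) :
    UniqueFactorizationMonoid (AddMonoidAlgebra k N) :=
  (AddMonoidAlgebra.domCongr k k e).toRingEquiv.toMulEquiv.uniqueFactorizationMonoid h

theorem AddMonoidAlgebra.uniqueFactorizationMonoid_fin (n : ℕ) :
    UniqueFactorizationMonoid (AddMonoidAlgebra k (Fin n → ℤ)) := by
  induction n with
  | zero =>
    have : Unique (Fin 0 → ℤ) := inferInstance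
    have e : k ≃* AddMonoidAlgebra k (Fin 0 → ℤ) :=
      (AddMonoidAlgebra.uniqueRingEquiv (Fin 0 → ℤ)).symm.toMulEquiv
    exact e.uniqueFactorizationMonoid inferInstance
  | succ n ih =>
    exact AddMonoidAlgebra.uniqueFactorizationMonoid_congr
      (Fin.consLinearEquiv ℤ (fun _ : Fin (n + 1) => ℤ)).toAddEquiv
      (AddMonoidAlgebra.uniqueFactorizationMonoid_int_prod k (Fin n → ℤ))

theorem AddMonoidAlgebra.isDomain_of_free (H : Type*) [AddCommGroup H] [Module.Free ℤ H]
    [Module.Finite ℤ H] : IsDomain (AddMonoidAlgebra k H) :=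
  AddMonoidAlgebra.isDomain_of_injective k (Module.finBasis ℤ H).equivFun.toAddEquiv.toAddMonoidHom
    (Module.finBasis ℤ H).equivFun.injective

theorem AddMonoidAlgebra.uniqueFactorizationMonoid_of_free (H : Type*) [AddCommGroup H]
    [Module.Free ℤ H] [Module.Finite ℤ H] : UniqueFactorizationMonoid (AddMonoidAlgebra k H) :=
  AddMonoidAlgebra.uniqueFactorizationMonoid_congr
    (Module.finBasis ℤ H).equivFun.symm.toAddEquiv
    (AddMonoidAlgebra.uniqueFactorizationMonoid_fin k _)

/-- The monoid of the elements of the lattice `G ⊆ ℤ²` in the closed half plane `{φ ≥ 0}`; for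
`φ = 0` this is `G` itself. -/
def latticeHalfPlane (G : Submodule ℤ (ℤ × ℤ)) (φ : ℤ × ℤ →ₗ[ℤ] ℤ) : AddSubmonoid (ℤ × ℤ) where
  carrier := {v | v ∈ G ∧ 0 ≤ φ v}
  add_mem' ha hb := ⟨G.add_mem ha.1 hb.1, by rw [map_add]; exact add_nonneg ha.2 hb.2⟩
  zero_mem' := ⟨G.zero_mem, by simp⟩

/-- If `φ` does not vanish on `G` and `e ∈ G` has the least positive value under `φ`, then
`latticeHalfPlane G φ = ℕ e ⊕ (G ∩ ker φ)`, so that its algebra is a polynomial ring over a ring of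
Laurent polynomials. -/
theorem latticeHalfPlane.uniqueFactorizationMonoid (G : Submodule ℤ (ℤ × ℤ))
    (φ : ℤ × ℤ →ₗ[ℤ] ℤ) :
    UniqueFactorizationMonoid (AddMonoidAlgebra k (latticeHalfPlane G φ)) := by
  by_cases h0 : ∀ v ∈ G, φ v = 0
  · have e : G ≃+ latticeHalfPlane G φ :=
      { toFun := fun v => ⟨v.1, v.2, (h0 _ v.2).ge⟩
        invFun := fun v => ⟨v.1, v.2.1⟩
        left_inv := fun _ => rfl
        right_inv := fun _ => rfl
        map_add' := fun _ _ => rfl }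
    exact AddMonoidAlgebra.uniqueFactorizationMonoid_congr e
      (AddMonoidAlgebra.uniqueFactorizationMonoid_of_free k G)
  · push Not at h0
    obtain ⟨v₀, hv₀, hφv₀⟩ := h0
    obtain ⟨e, heG, hepos, he⟩ : ∃ e ∈ G, 0 < φ e ∧ ∀ v ∈ G, φ e ∣ φ v := by
      obtain ⟨d, hd⟩ := (IsPrincipalIdealRing.principal (G.map φ)).principal
      have hdm : d ∈ G.map φ := hd ▸ Submodule.mem_span_singleton_self d
      obtain ⟨e, heG, rfl⟩ := hdm
      have hdvd : ∀ v ∈ G, φ e ∣ φ v := fun v hv => by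
        have : φ v ∈ G.map φ := Submodule.mem_map_of_mem hv
        rw [hd] at this
        exact Ideal.mem_span_singleton.1 this
      have hne : φ e ≠ 0 := fun h => hφv₀ (by simpa [h] using hdvd v₀ hv₀)
      rcases lt_or_gt_of_ne hne with h | h
      · exact ⟨-e, G.neg_mem heG, by simpa using h, fun v hv => by simpa using hdvd v hv⟩
      · exact ⟨e, heG, h, hdvd⟩
    let K : Submodule ℤ (ℤ × ℤ) := G ⊓ LinearMap.ker φ
    let f : ℕ × K →+ latticeHalfPlane G φ :=
      { toFun := fun p => ⟨p.1 • e + p.2.1, G.add_mem (G.nsmul_mem heG _) p.2.2.1, by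
          have : φ p.2.1 = 0 := p.2.2.2
          rw [map_add, this, map_nsmul]
          positivity⟩
        map_zero' := by ext <;> simp
        map_add' := fun p q => by
          refine Subtype.ext ?_
          change (p.1 + q.1) • e + (p.2.1 + q.2.1) = (p.1 • e + p.2.1) + (q.1 • e + q.2.1)
          rw [add_smul]; abel }
    have hf : Function.Bijective f := by
      constructor
      · rintro ⟨n, a, ha⟩ ⟨m, b, hb⟩ h
        have h1 : n • e + a = m • e + b := congrArg Subtype.val h
        have h2 := congrArg φ h1
        have ha0 : φ a = 0 := ha.2
        have hb0 : φ b = 0 := hb.2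
        rw [map_add, map_add, ha0, hb0, map_nsmul, map_nsmul, add_zero, add_zero, nsmul_eq_mul,
          nsmul_eq_mul] at h2
        obtain rfl : n = m := by exact_mod_cast mul_right_cancel₀ hepos.ne' h2
        obtain rfl : a = b := add_left_cancel h1
        rfl
      · rintro ⟨v, hv, hφv⟩
        obtain ⟨c, hc⟩ := he v hv
        have hc0 : 0 ≤ c := by
          by_contra hneg
          push Not at hneg
          nlinarith
        obtain ⟨n, rfl⟩ := Int.eq_ofNat_of_zero_le hc0
        refine ⟨⟨n, v - n • e, G.sub_mem hv (G.nsmul_mem heG _), ?_⟩, Subtype.ext ?_⟩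
        · change φ _ = 0
          rw [map_sub, map_nsmul, hc, nsmul_eq_mul]; ring
        · change n • e + (v - n • e) = v
          abel
    have h1 := AddMonoidAlgebra.isDomain_of_free k K
    have h2 := AddMonoidAlgebra.uniqueFactorizationMonoid_of_free k K
    exact AddMonoidAlgebra.uniqueFactorizationMonoid_congr (AddEquiv.ofBijective f hf)
      (AddMonoidAlgebra.uniqueFactorizationMonoid_nat_prod k K)

end FactorialMonoidAlgebras

/-! ### The transcendence degree of the Laurent polynomial ring -/

section TranscendenceDegree

variable (k : Type*) [Field k]

/-- The ring of Laurent polynomials in `X` and `Y` is algebraic over `k[X, Y]`. -/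
theorem trdeg_addMonoidAlgebra_int_prod_int_le :
    Algebra.trdeg k (AddMonoidAlgebra k (ℤ × ℤ)) ≤ 2 := by
  let X : AddMonoidAlgebra k (ℤ × ℤ) := .single (1, 0) 1
  let Y : AddMonoidAlgebra k (ℤ × ℤ) := .single (0, 1) 1
  let S := Algebra.adjoin k {X, Y}
  have hX : X ∈ S := Algebra.subset_adjoin (by simp)
  have hY : Y ∈ S := Algebra.subset_adjoin (by simp)
  have halg : Algebra.IsAlgebraic S (AddMonoidAlgebra k (ℤ × ℤ)) := by
    have inv : ∀ a b : AddMonoidAlgebra k (ℤ × ℤ), a ∈ S → a * b = 1 → IsAlgebraic S b := by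
      intro a b ha hab
      refine ⟨Polynomial.C ⟨a, ha⟩ * Polynomial.X - 1, fun h => ?_, ?_⟩
      · have := congrArg (fun p => Polynomial.coeff p 0) h
        simp at this
      · simp only [map_sub, map_mul, Polynomial.aeval_C, Polynomial.aeval_X, map_one]
        exact sub_eq_zero.2 hab
    have hmul : ∀ a b : ℤ × ℤ, (AddMonoidAlgebra.single a 1 : AddMonoidAlgebra k (ℤ × ℤ)) *
        .single b 1 = .single (a + b) 1 := fun a b => by
      rw [AddMonoidAlgebra.single_mul_single, mul_one]
    let T := Subalgebra.algebraicClosure S (AddMonoidAlgebra k (ℤ × ℤ))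
    have hS : ∀ a ∈ S, a ∈ T := fun a ha => isAlgebraic_algebraMap (⟨a, ha⟩ : S)
    have hX' : AddMonoidAlgebra.single (-1, 0) 1 ∈ T := inv X _ hX (by
      rw [hmul]; rfl)
    have hY' : AddMonoidAlgebra.single (0, -1) 1 ∈ T := inv Y _ hY (by
      rw [hmul]; rfl)
    have h1 : ∀ m : ℤ, AddMonoidAlgebra.single (m, 0) 1 ∈ T := by
      intro m
      obtain ⟨n, rfl | rfl⟩ := m.eq_nat_or_neg
      · have := pow_mem (hS _ hX) n
        simpa [X, AddMonoidAlgebra.single_pow] using this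
      · have := pow_mem hX' n
        simpa [AddMonoidAlgebra.single_pow] using this
    have h2 : ∀ m : ℤ, AddMonoidAlgebra.single (0, m) 1 ∈ T := by
      intro m
      obtain ⟨n, rfl | rfl⟩ := m.eq_nat_or_neg
      · have := pow_mem (hS _ hY) n
        simpa [Y, AddMonoidAlgebra.single_pow] using this
      · have := pow_mem hY' n
        simpa [AddMonoidAlgebra.single_pow] using this
    refine ⟨fun a => ?_⟩
    change a ∈ T
    induction a using AddMonoidAlgebra.induction_linear with
    | zero => exact zero_mem _
    | add a b ha hb => exact add_mem ha hb
    | single m r =>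
      have e : AddMonoidAlgebra.single m r = algebraMap k _ r *
          (AddMonoidAlgebra.single (m.1, 0) 1 * AddMonoidAlgebra.single (0, m.2) 1) := by
        rw [hmul, ← Algebra.smul_def, AddMonoidAlgebra.smul_single]
        simp
      rw [e]
      exact mul_mem (hS _ (S.algebraMap_mem r)) (mul_mem (h1 _) (h2 _))
  refine (Algebra.IsAlgebraic.trdeg_le_cardinalMk k {X, Y}).trans ?_
  have := Cardinal.mk_insert_le (s := {Y}) (a := X)
  rw [Cardinal.mk_singleton, one_add_one_eq_two] at this
  exact this

end TranscendenceDegree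

/-! ### Monoid algebras of submonoids of `ℤ²` -/

section Inclusions

variable (k : Type*) [Field k]

/-- The inclusion of monoid algebras `k[E] → k[F]` for submonoids `E ⊆ F`. -/
noncomputable def monoidAlgebraInclusion {E F : AddSubmonoid (ℤ × ℤ)} (h : E ≤ F) :
    AddMonoidAlgebra k E →ₐ[k] AddMonoidAlgebra k F :=
  AddMonoidAlgebra.mapDomainAlgHom k k (AddSubmonoid.inclusion h)

/-- The inclusion of the monoid algebra `k[E]` of a submonoid `E ⊆ ℤ²` into `k[ℤ²]`. -/
noncomputable def monoidAlgebraSubtype (E : AddSubmonoid (ℤ × ℤ)) :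
    AddMonoidAlgebra k E →ₐ[k] AddMonoidAlgebra k (ℤ × ℤ) :=
  AddMonoidAlgebra.mapDomainAlgHom k k E.subtype

variable {k}

theorem monoidAlgebraInclusion_injective {E F : AddSubmonoid (ℤ × ℤ)} (h : E ≤ F) :
    Function.Injective (monoidAlgebraInclusion k h) :=
  AddMonoidAlgebra.mapDomain_injective (AddSubmonoid.inclusion_injective h)

theorem monoidAlgebraSubtype_injective (E : AddSubmonoid (ℤ × ℤ)) :
    Function.Injective (monoidAlgebraSubtype k E) :=
  AddMonoidAlgebra.mapDomain_injective E.subtype_injective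

theorem monoidAlgebraInclusion_single {E F : AddSubmonoid (ℤ × ℤ)} (h : E ≤ F) (v : E) (r : k) :
    monoidAlgebraInclusion k h (.single v r) = .single (AddSubmonoid.inclusion h v) r :=
  AddMonoidAlgebra.mapDomain_single

theorem monoidAlgebraSubtype_comp_inclusion {E F : AddSubmonoid (ℤ × ℤ)} (h : E ≤ F)
    (a : AddMonoidAlgebra k E) :
    monoidAlgebraSubtype k F (monoidAlgebraInclusion k h a) = monoidAlgebraSubtype k E a := by
  have : (monoidAlgebraSubtype k F).comp (monoidAlgebraInclusion k h) =
      monoidAlgebraSubtype k E := by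
    ext; simp [monoidAlgebraSubtype, monoidAlgebraInclusion]
  exact congrArg (fun f => f a) this

theorem mem_range_monoidAlgebraSubtype {E : AddSubmonoid (ℤ × ℤ)}
    {a : AddMonoidAlgebra k (ℤ × ℤ)} :
    a ∈ Set.range (monoidAlgebraSubtype k E) ↔ ∀ v, a.coeff v ≠ 0 → v ∈ E := by
  constructor
  · rintro ⟨a, rfl⟩ v hv
    by_contra h
    exact hv (Finsupp.mapDomain_of_notMem_range _ _ (by simpa using h))
  · intro h
    refine ⟨AddMonoidAlgebra.comapDomain E.subtype E.subtype_injective a, ?_⟩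
    refine AddMonoidAlgebra.mapDomain_comapDomain (fun v hv => ?_) _
    exact ⟨⟨v, h v (by simpa using hv)⟩, rfl⟩

theorem trdeg_addMonoidAlgebra_le (E : AddSubmonoid (ℤ × ℤ)) :
    Algebra.trdeg k (AddMonoidAlgebra k E) ≤ 2 :=
  (trdeg_le_of_injective _ (monoidAlgebraSubtype_injective E)).trans
    (trdeg_addMonoidAlgebra_int_prod_int_le k)

/-- If `C = E ∩ F`, then `k[C] = k[E] ∩ k[F]`, and divisibility in `k[C]` can be tested in `k[E]`
and `k[F]`. -/
theorem dvd_of_dvd_of_dvd {C E F : AddSubmonoid (ℤ × ℤ)} (hE : C ≤ E) (hF : C ≤ F)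
    (hC : ∀ v ∈ E, v ∈ F → v ∈ C) {a b : AddMonoidAlgebra k C} (ha : a ≠ 0)
    (h1 : monoidAlgebraInclusion k hE a ∣ monoidAlgebraInclusion k hE b)
    (h2 : monoidAlgebraInclusion k hF a ∣ monoidAlgebraInclusion k hF b) : a ∣ b := by
  obtain ⟨c, hc⟩ := h1
  obtain ⟨d, hd⟩ := h2
  have hc' := congrArg (monoidAlgebraSubtype k E) hc
  have hd' := congrArg (monoidAlgebraSubtype k F) hd
  rw [map_mul, monoidAlgebraSubtype_comp_inclusion, monoidAlgebraSubtype_comp_inclusion] at hc' hd'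
  have hcd : monoidAlgebraSubtype k E c = monoidAlgebraSubtype k F d :=
    mul_left_cancel₀ ((map_ne_zero_iff _ (monoidAlgebraSubtype_injective C)).2 ha)
      (hc'.symm.trans hd')
  obtain ⟨q, hq⟩ : monoidAlgebraSubtype k E c ∈ Set.range (monoidAlgebraSubtype k C) :=
    mem_range_monoidAlgebraSubtype.2 fun v hv =>
      hC v (mem_range_monoidAlgebraSubtype.1 ⟨c, rfl⟩ v hv)
        (mem_range_monoidAlgebraSubtype.1 ⟨d, hcd.symm⟩ v hv)
  refine ⟨q, monoidAlgebraSubtype_injective C ?_⟩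
  rw [map_mul, hq, hc']

theorem isAwayHom_monoidAlgebraInclusion {E F : AddSubmonoid (ℤ × ℤ)} (h : E ≤ F) (z : E)
    (hz : -(z : ℤ × ℤ) ∈ F) (hF : ∀ v ∈ F, ∃ N : ℕ, v + N • (z : ℤ × ℤ) ∈ E) :
    IsAwayHom (monoidAlgebraInclusion k h).toRingHom (AddMonoidAlgebra.single z 1) where
  injective := monoidAlgebraInclusion_injective h
  isUnit := by
    refine IsUnit.of_mul_eq_one (AddMonoidAlgebra.single ⟨_, hz⟩ 1) ?_
    change monoidAlgebraInclusion k h _ * _ = _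
    rw [monoidAlgebraInclusion_single, AddMonoidAlgebra.single_mul_single, mul_one,
      AddMonoidAlgebra.one_def]
    congr 1
    exact Subtype.ext (add_neg_cancel (z : ℤ × ℤ))
  exists_pow_mul b := by
    change ∃ N r, monoidAlgebraInclusion k h r = monoidAlgebraInclusion k h _ ^ N * b
    induction b using AddMonoidAlgebra.induction_linear with
    | zero => exact ⟨0, 0, by simp⟩
    | add a b ha hb =>
      obtain ⟨N, r, hr⟩ := ha
      obtain ⟨M, s, hs⟩ := hb
      refine ⟨N + M, .single z 1 ^ M * r + .single z 1 ^ N * s, ?_⟩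
      rw [map_add, map_mul, map_mul, hr, hs, map_pow, map_pow]
      ring
    | single v r =>
      obtain ⟨N, hN⟩ := hF v v.2
      refine ⟨N, .single ⟨_, hN⟩ r, ?_⟩
      rw [monoidAlgebraInclusion_single, monoidAlgebraInclusion_single,
        AddMonoidAlgebra.single_pow, AddMonoidAlgebra.single_mul_single, one_pow, one_mul]
      congr 1
      refine Subtype.ext ?_
      change (v : ℤ × ℤ) + N • (z : ℤ × ℤ) = N • (z : ℤ × ℤ) + v
      exact add_comm _ _

/-- For a monoid without nontrivial units, the augmentation `k[C] → k` that sends all monomials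
other than `1` to `0`. -/
noncomputable def monoidAlgebraAugmentation (k : Type*) [Field k] (C : AddSubmonoid (ℤ × ℤ))
    (hC : ∀ a b : C, a + b = 0 → a = 0) : AddMonoidAlgebra k C →ₐ[k] k :=
  AddMonoidAlgebra.lift k k C
    { toFun := fun a => by
        classical exact if Multiplicative.toAdd a = 0 then 1 else 0
      map_one' := by simp
      map_mul' := fun a b => by
        by_cases ha : Multiplicative.toAdd a = 0
        · simp [ha]
        · have : Multiplicative.toAdd a + Multiplicative.toAdd b ≠ 0 := fun h => ha (hC _ _ h)
          simp [ha, this] }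

theorem monoidAlgebraAugmentation_single {C : AddSubmonoid (ℤ × ℤ)}
    (hC : ∀ a b : C, a + b = 0 → a = 0) {v : C} (hv : v ≠ 0) (r : k) :
    monoidAlgebraAugmentation k C hC (.single v r) = 0 := by
  simp [monoidAlgebraAugmentation, hv]

theorem exists_dvd_pow_of_monoidAlgebraAugmentation_eq_zero {C : AddSubmonoid (ℤ × ℤ)}
    (hC : ∀ a b : C, a + b = 0 → a = 0) (z : C)
    (hz : ∀ v : C, v ≠ 0 → ∃ N : ℕ, ∃ c : C, N • v = z + c) (a : AddMonoidAlgebra k C)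
    (ha : monoidAlgebraAugmentation k C hC a = 0) :
    ∃ n, AddMonoidAlgebra.single z 1 ∣ a ^ n := by
  have key : ∀ b : AddMonoidAlgebra k C,
      b - algebraMap k _ (monoidAlgebraAugmentation k C hC b) ∈
        (Ideal.span {(AddMonoidAlgebra.single z 1 : AddMonoidAlgebra k C)}).radical := by
    intro b
    induction b using AddMonoidAlgebra.induction_linear with
    | zero => simp
    | add a b ha hb =>
      rw [map_add, map_add, add_sub_add_comm]
      exact add_mem ha hb
    | single v r =>
      by_cases hv : v = 0
      · subst hv
        have : (AddMonoidAlgebra.single 0 r : AddMonoidAlgebra k C) = algebraMap k _ r := rfl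
        rw [this, AlgHom.commutes]
        simp
      · rw [monoidAlgebraAugmentation_single hC hv, map_zero, sub_zero]
        obtain ⟨N, c, hc⟩ := hz v hv
        refine ⟨N, Ideal.mem_span_singleton.2 ⟨.single c (r ^ N), ?_⟩⟩
        rw [AddMonoidAlgebra.single_pow, AddMonoidAlgebra.single_mul_single, hc, one_mul]
  have h1 := key a
  rw [ha, map_zero, sub_zero] at h1
  obtain ⟨n, hn⟩ := h1
  exact ⟨n, Ideal.mem_span_singleton.1 hn⟩

end Inclusions

/-! ### Lattice points of plane cones -/

section LatticeCones

theorem exists_nat_forall_pos (a : ℤ) {b : ℤ} (hb : 0 < b) :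
    ∃ N : ℕ, ∀ M : ℕ, N ≤ M → 0 < a + M * b := by
  refine ⟨a.natAbs + 1, fun M hM => ?_⟩
  have h1 : (a.natAbs : ℤ) + 1 ≤ M := by exact_mod_cast hM
  have h2 : -a ≤ a.natAbs := by omega
  nlinarith

/-- An integral linear form `φ` defines the lattice points of the half plane `L`. -/
theorem IsRationalHalfPlane.exists_form {L : Set (ℝ × ℝ)} (hL : IsRationalHalfPlane L) :
    ∃ φ : ℤ × ℤ →ₗ[ℤ] ℤ, φ ≠ 0 ∧
      ((∀ v : ℤ × ℤ, ((v.1 : ℝ), (v.2 : ℝ)) ∈ L ↔ 0 < φ v) ∨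
        ∀ v : ℤ × ℤ, ((v.1 : ℝ), (v.2 : ℝ)) ∈ L ↔ 0 ≤ φ v) := by
  obtain ⟨f, hf, ⟨v, hv, hfv⟩, hL⟩ := hL
  have hfe : ∀ a b : ℝ, f (a, b) = a * f (1, 0) + b * f (0, 1) := fun a b => by
    have : ((a, b) : ℝ × ℝ) = a • (1, 0) + b • (0, 1) := by ext <;> simp
    rw [this, map_add, map_smul, map_smul, smul_eq_mul, smul_eq_mul]
  -- `f` is a multiple of the form `w ↦ w_1 v_2 - w_2 v_1` that vanishes on the boundary vector `v`
  obtain ⟨c, hc1, hc2⟩ : ∃ c : ℝ, f (1, 0) = c * v.2 ∧ f (0, 1) = -(c * v.1) := by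
    rw [hfe] at hfv
    by_cases h2 : (v.2 : ℝ) = 0
    · have h1 : (v.1 : ℝ) ≠ 0 := fun h1 =>
        hv (Prod.ext (by exact_mod_cast h1) (by exact_mod_cast h2))
      rw [h2, zero_mul, add_zero] at hfv
      have := (mul_eq_zero.1 hfv).resolve_left h1
      exact ⟨-(f (0, 1) / v.1), by rw [this, h2, mul_zero], by field_simp⟩
    · refine ⟨f (1, 0) / v.2, by field_simp, ?_⟩
      field_simp
      linear_combination hfv
  have hc : c ≠ 0 := by
    rintro rfl
    refine hf (LinearMap.ext fun w => ?_)
    have := hfe w.1 w.2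
    rw [hc1, hc2] at this
    simpa using this
  let φ : ℤ × ℤ →ₗ[ℤ] ℤ := v.2 • LinearMap.fst ℤ ℤ ℤ - v.1 • LinearMap.snd ℤ ℤ ℤ
  have hφ : ∀ w : ℤ × ℤ, f ((w.1 : ℝ), (w.2 : ℝ)) = c * (φ w : ℤ) := fun w => by
    rw [hfe, hc1, hc2]
    simp only [φ, LinearMap.sub_apply, LinearMap.smul_apply, LinearMap.fst_apply,
      LinearMap.snd_apply, smul_eq_mul]
    push_cast
    ring
  have hφ0 : φ ≠ 0 := by
    intro h
    have h1 := LinearMap.congr_fun h (1, 0)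
    have h2 := LinearMap.congr_fun h (0, 1)
    simp [φ] at h1 h2
    exact hv (Prod.ext h2 h1)
  rcases lt_or_gt_of_ne hc with h | h
  · refine ⟨-φ, neg_ne_zero.2 hφ0, ?_⟩
    rcases hL with rfl | rfl
    · refine Or.inl fun w => ?_
      rw [Set.mem_ofPred_eq, hφ, LinearMap.neg_apply, Left.neg_pos_iff,
        ← neg_mul_neg, mul_pos_iff_of_pos_left (neg_pos.2 h)]
      norm_cast
      simp
    · refine Or.inr fun w => ?_
      rw [Set.mem_ofPred_eq, hφ, LinearMap.neg_apply, Left.nonneg_neg_iff,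
        ← neg_mul_neg, mul_nonneg_iff_of_pos_left (neg_pos.2 h)]
      norm_cast
      simp
  · refine ⟨φ, hφ0, ?_⟩
    rcases hL with rfl | rfl
    · refine Or.inl fun w => ?_
      rw [Set.mem_ofPred_eq, hφ, mul_pos_iff_of_pos_left h]
      norm_cast
    · refine Or.inr fun w => ?_
      rw [Set.mem_ofPred_eq, hφ, mul_nonneg_iff_of_pos_left h]
      norm_cast

/-- Two integral linear forms are either proportional, or `ψ` is positive somewhere on the line
`φ = 0`. -/
theorem exists_edge_vector_or_proportional {φ ψ : ℤ × ℤ →ₗ[ℤ] ℤ} (hφ : φ ≠ 0) :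
    (∃ v, φ v = 0 ∧ 0 < ψ v) ∨ ∃ a b : ℤ, 0 < a ∧ ∀ w, a * ψ w = b * φ w := by
  by_cases h : ∀ v, φ v = 0 → ψ v = 0
  · right
    obtain ⟨u, hu⟩ : ∃ u, φ u ≠ 0 := by
      by_contra! h0
      exact hφ (LinearMap.ext h0)
    have key : ∀ w, φ u * ψ w = ψ u * φ w := fun w => by
      have := h (φ u • w - φ w • u) (by
        rw [map_sub, map_smul, map_smul, smul_eq_mul, smul_eq_mul, mul_comm, sub_self])
      simp only [map_sub, map_smul, smul_eq_mul] at this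
      linear_combination this
    rcases lt_or_gt_of_ne hu with h | h
    · exact ⟨-φ u, -ψ u, by linarith, fun w => by linear_combination -key w⟩
    · exact ⟨φ u, ψ u, h, key⟩
  · push Not at h
    obtain ⟨v, hv, hψ⟩ := h
    rcases lt_or_gt_of_ne hψ with h | h
    · exact Or.inl ⟨-v, by simpa using hv, by simpa using h⟩
    · exact Or.inl ⟨v, hv, h⟩

variable {k : Type*} [Field k] {C : AddSubmonoid (ℤ × ℤ)} {G : Submodule ℤ (ℤ × ℤ)}
  {φ ψ : ℤ × ℤ →ₗ[ℤ] ℤ}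

/-- If `C` is the intersection of two closed half planes in a lattice, with edge vectors `y` and
`z`, then `k[C]` is the intersection of the factorial rings `k[C][1/y]` and `k[C][1/z]`. -/
theorem hasRegularParameterPairs_of_inter (hφ : C ≤ latticeHalfPlane G φ)
    (hψ : C ≤ latticeHalfPlane G ψ)
    (hC : ∀ v ∈ latticeHalfPlane G φ, v ∈ latticeHalfPlane G ψ → v ∈ C)
    {y z : ℤ × ℤ} (hy : y ∈ C) (hz : z ∈ C) (hφy : φ y = 0) (hψz : ψ z = 0)
    (hyC : ∀ v ∈ latticeHalfPlane G φ, ∃ N : ℕ, v + N • y ∈ C)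
    (hzC : ∀ v ∈ latticeHalfPlane G ψ, ∃ N : ℕ, v + N • z ∈ C) :
    HasRegularParameterPairs (AddMonoidAlgebra k C) := by
  intro x hx hx0 r h
  have h1 := latticeHalfPlane.uniqueFactorizationMonoid k G φ
  have h2 := latticeHalfPlane.uniqueFactorizationMonoid k G ψ
  exact dvd_of_dvd_of_dvd hφ hψ hC (hx0 0)
    (hx.dvd_of_isAwayHom (isAwayHom_monoidAlgebraInclusion hφ ⟨y, hy⟩
      ⟨G.neg_mem (hφ hy).1, by simp [hφy]⟩ hyC) hx0 h)
    (hx.dvd_of_isAwayHom (isAwayHom_monoidAlgebraInclusion hψ ⟨z, hz⟩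
      ⟨G.neg_mem (hψ hz).1, by simp [hψz]⟩ hzC) hx0 h)

theorem hasRegularParameterPairs_of_eq (hC : ∀ v, v ∈ C ↔ v ∈ G ∧ 0 ≤ φ v) :
    HasRegularParameterPairs (AddMonoidAlgebra k C) :=
  hasRegularParameterPairs_of_inter (G := G) (φ := φ) (ψ := φ) (fun v hv => (hC v).1 hv)
    (fun v hv => (hC v).1 hv) (fun v hv _ => (hC v).2 hv) C.zero_mem C.zero_mem (map_zero φ)
    (map_zero φ) (fun v hv => ⟨0, by simpa using (hC v).2 hv⟩)
    (fun v hv => ⟨0, by simpa using (hC v).2 hv⟩)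

/-- If `C` has no nontrivial units and every nonzero element of `C` has a multiple in `z + C`, then
the maximal ideal generated by the nontrivial monomials is the radical of the principal ideal
generated by the monomial of `z`. -/
theorem hasRegularParameterPairs_of_archimedean (hφ : C ≤ latticeHalfPlane G φ)
    {z : ℤ × ℤ} (hz : z ∈ C) (hz0 : z ≠ 0) (hφz : φ z = 0)
    (hzC : ∀ v ∈ latticeHalfPlane G φ, ∃ N : ℕ, v + N • z ∈ C)
    (hpos : ∀ v ∈ C, ∀ w ∈ C, v + w = 0 → v = 0)
    (harch : ∀ v ∈ C, v ≠ 0 → ∃ N : ℕ, N • v - z ∈ C) :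
    HasRegularParameterPairs (AddMonoidAlgebra k C) := by
  intro x hx hx0 r h
  have h1 := latticeHalfPlane.uniqueFactorizationMonoid k G φ
  have hunits : ∀ a b : C, a + b = 0 → a = 0 := fun a b hab =>
    Subtype.ext (hpos a a.2 b b.2 (congrArg Subtype.val hab))
  have hz0' : (⟨z, hz⟩ : C) ≠ 0 := fun e => hz0 (congrArg Subtype.val e)
  refine hx.dvd_of_augmentation (isAwayHom_monoidAlgebraInclusion hφ ⟨z, hz⟩
    ⟨G.neg_mem (hφ hz).1, by simp [hφz]⟩ hzC) (trdeg_addMonoidAlgebra_le _)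
    (monoidAlgebraAugmentation_single hunits hz0' 1)
    (exists_dvd_pow_of_monoidAlgebraAugmentation_eq_zero hunits _ fun v hv => ?_) hx0 h
  obtain ⟨N, hN⟩ := harch v v.2 fun e => hv (Subtype.ext e)
  refine ⟨N, ⟨_, hN⟩, Subtype.ext ?_⟩
  change N • (v : ℤ × ℤ) = z + (N • (v : ℤ × ℤ) - z)
  abel

/-- The hypothesis `hG` says that `φ` and `ψ` vanish on `G` as soon as they vanish on `C`; it holds
when `C` generates `G`. -/
theorem hasRegularParameterPairs_of_closed_closed (hφ : φ ≠ 0) (hψ : ψ ≠ 0)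
    (hG : ∀ v ∈ G, (∀ w ∈ C, φ w = 0 ∧ ψ w = 0) → φ v = 0 ∧ ψ v = 0)
    (hC : ∀ v, v ∈ C ↔ v ∈ G ∧ 0 ≤ φ v ∧ 0 ≤ ψ v)
    (hint : ∀ v, 0 ≤ φ v → 0 ≤ ψ v → ∃ t : ℕ, 0 < t ∧ t • v ∈ C) :
    HasRegularParameterPairs (AddMonoidAlgebra k C) := by
  rcases exists_edge_vector_or_proportional (ψ := ψ) hφ with ⟨y, hφy, hψy⟩ | ⟨a, b, ha, hab⟩
  · rcases exists_edge_vector_or_proportional (ψ := φ) hψ with ⟨z, hψz, hφz⟩ | ⟨a, b, ha, hab⟩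
    · obtain ⟨s, hs, hsy⟩ := hint y hφy.ge hψy.le
      obtain ⟨t, ht, htz⟩ := hint z hφz.le hψz.ge
      refine hasRegularParameterPairs_of_inter (G := G) (φ := φ) (ψ := ψ)
        (fun v hv => ⟨((hC v).1 hv).1, ((hC v).1 hv).2.1⟩)
        (fun v hv => ⟨((hC v).1 hv).1, ((hC v).1 hv).2.2⟩)
        (fun v hv hw => (hC v).2 ⟨hv.1, hv.2, hw.2⟩) hsy htz
        (by rw [map_nsmul, hφy, smul_zero]) (by rw [map_nsmul, hψz, smul_zero])
        (fun v hv => ?_) (fun v hv => ?_)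
      · have hp : 0 < ψ (s • y) := by rw [map_nsmul]; positivity
        obtain ⟨N, hN⟩ := exists_nat_forall_pos (ψ v) hp
        refine ⟨N, (hC _).2 ⟨G.add_mem hv.1 (G.nsmul_mem ((hC _).1 hsy).1 _), ?_, ?_⟩⟩
        · rw [map_add, map_nsmul, map_nsmul, hφy, smul_zero, smul_zero, add_zero]; exact hv.2
        · rw [map_add, map_nsmul, nsmul_eq_mul]; exact (hN N le_rfl).le
      · have hp : 0 < φ (t • z) := by rw [map_nsmul]; positivity
        obtain ⟨N, hN⟩ := exists_nat_forall_pos (φ v) hp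
        refine ⟨N, (hC _).2 ⟨G.add_mem hv.1 (G.nsmul_mem ((hC _).1 htz).1 _), ?_, ?_⟩⟩
        · rw [map_add, map_nsmul, nsmul_eq_mul]; exact (hN N le_rfl).le
        · rw [map_add, map_nsmul, map_nsmul, hψz, smul_zero, smul_zero, add_zero]; exact hv.2
    · exfalso
      have hb : b = 0 := by
        have := hab y
        rw [hφy, mul_zero] at this
        exact (mul_eq_zero.1 this.symm).resolve_right hψy.ne'
      refine hφ (LinearMap.ext fun w => ?_)
      have := hab w
      rw [hb, zero_mul] at this
      exact (mul_eq_zero.1 this).resolve_left ha.ne'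
  · have hb : b ≠ 0 := by
      rintro rfl
      refine hψ (LinearMap.ext fun w => ?_)
      have := hab w
      rw [zero_mul] at this
      exact (mul_eq_zero.1 this).resolve_left ha.ne'
    refine hasRegularParameterPairs_of_eq (G := G) (φ := φ) fun v => ?_
    rw [hC]
    refine ⟨fun h => ⟨h.1, h.2.1⟩, fun h => ⟨h.1, h.2, ?_⟩⟩
    rcases lt_or_gt_of_ne hb with hb | hb
    · -- for opposite half planes, `C` is the group of the lattice points on the common boundary
      refine (hG v h.1 fun w hw => ?_).2.ge
      obtain ⟨-, h1, h2⟩ := (hC w).1 hw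
      have := hab w
      have e1 : φ w = 0 := by nlinarith [mul_nonneg ha.le h2]
      rw [e1, mul_zero] at this
      exact ⟨e1, (mul_eq_zero.1 this).resolve_left ha.ne'⟩
    · have := hab v
      have h3 : 0 ≤ a * ψ v := this ▸ mul_nonneg hb.le h.2
      exact nonneg_of_mul_nonneg_right h3 ha

theorem hasRegularParameterPairs_of_open_open
    (hC : ∀ v, v ∈ C ↔ v ∈ G ∧ (v = 0 ∨ 0 < φ v ∧ 0 < ψ v)) {z : ℤ × ℤ} (hz : z ∈ C)
    (hz0 : z ≠ 0) : HasRegularParameterPairs (AddMonoidAlgebra k C) := by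
  obtain ⟨hzG, hz'⟩ := (hC z).1 hz
  obtain ⟨hφz, hψz⟩ := hz'.resolve_left hz0
  -- any nonzero `z ∈ C` will do: inverting its monomial yields `k[G]`
  refine hasRegularParameterPairs_of_archimedean (G := G) (φ := 0)
    (fun v hv => ⟨((hC v).1 hv).1, le_rfl⟩) hz hz0 rfl (fun v hv => ?_) (fun v hv w hw hvw => ?_)
    fun v hv hv0 => ?_
  · obtain ⟨N, hN⟩ := exists_nat_forall_pos (φ v) hφz
    obtain ⟨M, hM⟩ := exists_nat_forall_pos (ψ v) hψz
    refine ⟨N + M, (hC _).2 ⟨G.add_mem hv.1 (G.nsmul_mem hzG _), Or.inr ⟨?_, ?_⟩⟩⟩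
    · rw [map_add, map_nsmul, nsmul_eq_mul]; exact hN _ (by omega)
    · rw [map_add, map_nsmul, nsmul_eq_mul]; exact hM _ (by omega)
  · by_contra hv0
    have h1 := (((hC v).1 hv).2.resolve_left hv0).1
    have h2 : 0 ≤ φ w := by
      rcases ((hC w).1 hw).2 with rfl | h
      · simp
      · exact h.1.le
    have := congrArg φ hvw
    rw [map_add, map_zero] at this
    omega
  · obtain ⟨hvG, hv⟩ := (hC v).1 hv
    obtain ⟨hφv, hψv⟩ := hv.resolve_left hv0
    obtain ⟨N, hN⟩ := exists_nat_forall_pos (-φ z) hφv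
    obtain ⟨M, hM⟩ := exists_nat_forall_pos (-ψ z) hψv
    refine ⟨N + M, (hC _).2 ⟨G.sub_mem (G.nsmul_mem hvG _) hzG, Or.inr ⟨?_, ?_⟩⟩⟩
    · rw [map_sub, map_nsmul, nsmul_eq_mul]; linarith [hN (N + M) (by omega)]
    · rw [map_sub, map_nsmul, nsmul_eq_mul]; linarith [hM (N + M) (by omega)]

theorem hasRegularParameterPairs_of_bot (hC : ∀ v ∈ C, v = 0) :
    HasRegularParameterPairs (AddMonoidAlgebra k C) :=
  hasRegularParameterPairs_of_eq (G := ⊥) (φ := 0) fun v => by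
    rw [Submodule.mem_bot]
    exact ⟨fun h => ⟨hC v h, le_rfl⟩, fun h => h.1 ▸ C.zero_mem⟩

theorem hasRegularParameterPairs_of_open_closed (hψ : ψ ≠ 0)
    (hC : ∀ v, v ∈ C ↔ v ∈ G ∧ (v = 0 ∨ 0 < φ v ∧ 0 ≤ ψ v))
    (hint : ∀ v, 0 < φ v → 0 ≤ ψ v → ∃ t : ℕ, 0 < t ∧ t • v ∈ C) :
    HasRegularParameterPairs (AddMonoidAlgebra k C) := by
  by_cases hbot : ∀ v ∈ C, v = 0
  · exact hasRegularParameterPairs_of_bot hbot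
  push Not at hbot
  obtain ⟨u, hu, hu0⟩ := hbot
  obtain ⟨hφu, hψu⟩ := ((hC u).1 hu).2.resolve_left hu0
  rcases exists_edge_vector_or_proportional (ψ := φ) hψ with ⟨y, hψy, hφy⟩ | ⟨a, b, ha, hab⟩
  · -- a point `z ∈ C` on the closed edge `ψ = 0`; inverting its monomial yields `k[G ∩ {ψ ≥ 0}]`
    obtain ⟨t, ht, hty⟩ := hint y hφy hψy.ge
    have hψz : ψ (t • y) = 0 := by rw [map_nsmul, hψy, smul_zero]
    have hφz : 0 < φ (t • y) := by rw [map_nsmul]; positivity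
    have hz0 : t • y ≠ 0 := fun h => by rw [h, map_zero] at hφz; exact hφz.ne rfl
    generalize t • y = z at *
    refine hasRegularParameterPairs_of_archimedean (G := G) (φ := ψ) (fun v hv => ?_) hty hz0 hψz
      (fun v hv => ?_) (fun v hv w hw hvw => ?_) fun v hv hv0 => ?_
    · refine ⟨((hC v).1 hv).1, ?_⟩
      rcases ((hC v).1 hv).2 with rfl | h
      · simp
      · exact h.2
    · obtain ⟨N, hN⟩ := exists_nat_forall_pos (φ v) hφz
      refine ⟨N, (hC _).2 ⟨G.add_mem hv.1 (G.nsmul_mem ((hC z).1 hty).1 _), Or.inr ⟨?_, ?_⟩⟩⟩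
      · rw [map_add, map_nsmul, nsmul_eq_mul]; exact hN _ le_rfl
      · rw [map_add, map_nsmul, hψz, smul_zero, add_zero]; exact hv.2
    · by_contra hv0
      have h1 := (((hC v).1 hv).2.resolve_left hv0).1
      have h2 : 0 ≤ φ w := by
        rcases ((hC w).1 hw).2 with rfl | h
        · simp
        · exact h.1.le
      have := congrArg φ hvw
      rw [map_add, map_zero] at this
      omega
    · obtain ⟨hvG, hv⟩ := (hC v).1 hv
      obtain ⟨hφv, hψv⟩ := hv.resolve_left hv0
      obtain ⟨N, hN⟩ := exists_nat_forall_pos (-φ z) hφv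
      refine ⟨N, (hC _).2 ⟨G.sub_mem (G.nsmul_mem hvG _) ((hC z).1 hty).1, Or.inr ⟨?_, ?_⟩⟩⟩
      · rw [map_sub, map_nsmul, nsmul_eq_mul]; linarith [hN N le_rfl]
      · rw [map_sub, map_nsmul, hψz, sub_zero]; positivity
  · -- the half planes are equal up to their boundary, which does not meet `{φ > 0}`
    refine hasRegularParameterPairs_of_open_open (G := G) (φ := φ) (ψ := φ) (fun v => ?_) hu hu0
    rw [hC, and_self_iff]
    refine and_congr_right fun _ => or_congr_right ⟨fun h => h.1, fun h => ⟨h, ?_⟩⟩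
    have hb : 0 < b := by
      have h1 : 0 < b * ψ u := hab u ▸ mul_pos ha hφu
      exact pos_of_mul_pos_left h1 hψu
    have h1 : 0 < b * ψ v := hab v ▸ mul_pos ha h
    exact (pos_of_mul_pos_right h1 hb.le).le

end LatticeCones

/-! ### Full integral submonoids -/

section FullIntegralSubmonoids

variable {C D : AddSubmonoid (ℤ × ℤ)}

theorem IsFullIn.mem_of_mem_span (hfull : IsFullIn C D) {v : ℤ × ℤ}
    (hv : v ∈ Submodule.span ℤ (C : Set (ℤ × ℤ))) (hvD : v ∈ D) : v ∈ C := by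
  obtain ⟨a, ha, b, hb, rfl⟩ : ∃ a ∈ C, ∃ b ∈ C, a - b = v := by
    clear hvD
    induction hv using Submodule.span_induction with
    | mem v hv => exact ⟨v, hv, 0, C.zero_mem, sub_zero v⟩
    | zero => exact ⟨0, C.zero_mem, 0, C.zero_mem, sub_zero 0⟩
    | add v w _ _ hv hw =>
      obtain ⟨a, ha, b, hb, rfl⟩ := hv
      obtain ⟨c, hc, d, hd, rfl⟩ := hw
      exact ⟨a + c, C.add_mem ha hc, b + d, C.add_mem hb hd, by abel⟩
    | smul n v _ hv =>
      obtain ⟨a, ha, b, hb, rfl⟩ := hv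
      obtain ⟨n, rfl | rfl⟩ := n.eq_nat_or_neg
      · exact ⟨n • a, C.nsmul_mem ha n, n • b, C.nsmul_mem hb n, by
          rw [Nat.cast_smul_eq_nsmul, smul_sub]⟩
      · exact ⟨n • b, C.nsmul_mem hb n, n • a, C.nsmul_mem ha n, by
          rw [neg_smul, Nat.cast_smul_eq_nsmul, smul_sub, neg_sub]⟩
  exact hfull a ha b hb hvD

theorem hasRegularParameterPairs_of_isFullIn (k : Type*) [Field k]
    (hD : IsQuasiRationalConeMonoid D) (hCD : C ≤ D) (hfull : IsFullIn C D)
    (hint : IsIntegralIn C D) : HasRegularParameterPairs (AddMonoidAlgebra k C) := by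
  obtain ⟨L₁, L₂, hL₁, hL₂, hD⟩ := hD
  obtain ⟨φ, hφ, h₁⟩ := hL₁.exists_form
  obtain ⟨ψ, hψ, h₂⟩ := hL₂.exists_form
  simp only [Set.mem_inter_iff] at hD
  have hC : ∀ v, v ∈ C ↔ v ∈ Submodule.span ℤ (C : Set (ℤ × ℤ)) ∧ v ∈ D := fun v =>
    ⟨fun h => ⟨Submodule.subset_span h, hCD h⟩, fun h => hfull.mem_of_mem_span h.1 h.2⟩
  rcases h₁ with h₁ | h₁ <;> rcases h₂ with h₂ | h₂ <;> simp only [h₁, h₂] at hD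
  · by_cases hbot : ∀ v ∈ C, v = 0
    · exact hasRegularParameterPairs_of_bot hbot
    push Not at hbot
    obtain ⟨z, hz, hz0⟩ := hbot
    exact hasRegularParameterPairs_of_open_open (fun v => by rw [hC, hD]) hz hz0
  · exact hasRegularParameterPairs_of_open_closed hψ (fun v => by rw [hC, hD])
      fun v h h' => hint v ((hD v).2 (Or.inr ⟨h, h'⟩))
  · exact hasRegularParameterPairs_of_open_closed hφ
      (fun v => by rw [hC, hD, and_comm (a := 0 ≤ φ v)])
      fun v h h' => hint v ((hD v).2 (Or.inr ⟨h', h⟩))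
  · refine hasRegularParameterPairs_of_closed_closed
      (G := Submodule.span ℤ (C : Set (ℤ × ℤ))) hφ hψ (fun v hv h => ?_) (fun v => ?_)
      fun v h h' => hint v ((hD v).2 (Or.inr ⟨h, h'⟩))
    · have : Submodule.span ℤ (C : Set (ℤ × ℤ)) ≤ LinearMap.ker φ ⊓ LinearMap.ker ψ :=
        Submodule.span_le.2 fun w hw => h w hw
      exact this hv
    · rw [hC, hD, or_iff_right_of_imp]
      rintro rfl
      simp

theorem isNormalMonoid_of_isFullIn (hD : IsQuasiRationalConeMonoid D) (hCD : C ≤ D)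
    (hfull : IsFullIn C D) : IsNormalMonoid C := by
  intro a ha b hb t ht h
  refine hfull a ha b hb ?_
  obtain ⟨L₁, L₂, hL₁, hL₂, hD⟩ := hD
  obtain ⟨φ, -, h₁⟩ := hL₁.exists_form
  obtain ⟨ψ, -, h₂⟩ := hL₂.exists_form
  simp only [Set.mem_inter_iff] at hD
  have hpos : ∀ (χ : ℤ × ℤ →ₗ[ℤ] ℤ) (v : ℤ × ℤ),
      (0 < χ (t • v) → 0 < χ v) ∧ (0 ≤ χ (t • v) → 0 ≤ χ v) := fun χ v => by
    have ht' : (0 : ℤ) < t := by exact_mod_cast ht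
    rw [map_nsmul, nsmul_eq_mul]
    exact ⟨(mul_pos_iff_of_pos_left ht').1, (mul_nonneg_iff_of_pos_left ht').1⟩
  rcases (hD _).1 (hCD h) with h0 | ⟨hφ, hψ⟩
  · exact (hD _).2 (Or.inl ((smul_eq_zero.1 h0).resolve_left ht.ne'))
  · refine (hD _).2 (Or.inr ⟨?_, ?_⟩)
    · rcases h₁ with h₁ | h₁ <;> rw [h₁] at hφ ⊢
      · exact (hpos φ _).1 hφ
      · exact (hpos φ _).2 hφ
    · rcases h₂ with h₂ | h₂ <;> rw [h₂] at hψ ⊢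
      · exact (hpos ψ _).1 hψ
      · exact (hpos ψ _).2 hψ

end FullIntegralSubmonoids

theorem mainTheorem7 (k : Type*) [Field k] (C D : AddSubmonoid (ℤ × ℤ))
    (hD : IsQuasiRationalConeMonoid D) (hCD : C ≤ D)
    (hfull : IsFullIn C D) (hint : IsIntegralIn C D) :
    IsNormalMonoid C ∧
    (∀ (l : ℕ) (x : Fin l → AddMonoidAlgebra k C), IsParameterSequence x →
      RingTheory.Sequence.IsRegular (AddMonoidAlgebra k C) (List.ofFn x)) ∧
    IsCohenMacaulayHM (AddMonoidAlgebra k C) := by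
  have main : ∀ (l : ℕ) (x : Fin l → AddMonoidAlgebra k C), IsParameterSequence x →
      RingTheory.Sequence.IsRegular (AddMonoidAlgebra k C) (List.ofFn x) := by
    intro l x hx
    by_cases hl : l ≤ 2
    · exact hx.isRegular_of_le_two hl (hasRegularParameterPairs_of_isFullIn k hD hCD hfull hint)
    · exact (hx.not_forall_topCechVanishesAt fun p _ => topCechVanishesAt_of_dependent x
        (not_algebraicIndependent_of_trdeg_le (trdeg_addMonoidAlgebra_le (k := k) C)
          (by omega)) p).elim
  exact ⟨isNormalMonoid_of_isFullIn hD hCD hfull, main, fun l hl x hx => main l x (hx l le_rfl hl)⟩
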